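/- Let $q$ be a prime power, $A=\mathbb{F}_q[\theta]$, $K=\mathbb{F}_q(\theta)$ with $|x|_\infty=q^{\deg x}$, $K_\infty$ its completion, $\mathbb{C}_\infty$ the completion of an algebraic closure of $K_\infty$, and $\mathbb{K}\subseteq\mathbb{C}_\infty$ an algebraically closed field containing $K$ (for example the algebraic closure $\overline{K}$ of $K$ in $\mathbb{C}_\infty$). For $f=\sum_i a_it^i\in\mathbb{C}_\infty((t))$ and $n\in\mathbb{Z}$ put $f^{(n)}=\sum_i a_i^{q^n}t^i$ (entrywise for matrices and vectors), let $\partial_t^n f=\sum_i\binom{i}{n}a_it^{i-n}$ be the hyperderivatives, and let $\mathbb{T}_\theta=\{\sum_{i\ge0}b_it^i : |b_i\theta^i|_\infty\to0\}$. For a polynomial $Q$, $\|Q\|_1$ is the maximum of the absolute values of its coefficients. Let $r\ge1$, let $s_1,\dots,s_r\ge1$ be integers, $d_i=s_i+\cdots+s_r$, $d=d_1+\cdots+d_r$, and let $Q_1,\dots,Q_{r-1}\in\mathbb{K}[t]$. Let $\Phi'\in\mathrm{Mat}_r(\mathbb{K}[t])$ be the matrix with diagonal entries $\Phi'_{i,i}=(t-\theta)^{d_i}$,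 subdiagonal entries $\Phi'_{i+1,i}=Q_i^{(-1)}(t-\theta)^{d_i}$, and zeros elsewhere. Let $M'=\mathrm{Mat}_{1\times r}(\mathbb{K}[t])$ with standard $\mathbb{K}[t]$-basis $m_1,\dots,m_r$ and with $\sigma a=a^{(-1)}\Phi'$; it is free over $\mathbb{K}[\sigma]$ (where $\sigma x=x^{1/q}\sigma$ for $x\in\mathbb{K}$) with basis $(e_1,\dots,e_d)=\big((t-\theta)^{d_1-1}m_1,\dots,m_1,\dots,(t-\theta)^{d_r-1}m_r,\dots,m_r\big)$. Let $\Delta:M'\to\mathbb{K}^d$ be the map $\sum_{l,n}x_{l,n}\sigma^ne_l\mapsto\big(\sum_n x_{l,n}^{q^n}\big)_l$ with $x_{l,n}\in\mathbb{K}$, which induces $M'/(\sigma-1)M'\cong\mathbb{K}^d$, and let $G=(\mathbb{G}_a^d,\rho)$ be the $t$-module over $\mathbb{K}$ with $\rho(t)\Delta(m)=\Delta(tm)$ for $m\in M'$. Its exponential is $\mathrm{Exp}_G(\mathbf{z})=\sum_{i\ge0}E_i\mathbf{z}^{(i)}$, where the matrices $E_i\in\mathrm{Mat}_d(\mathbb{K})$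 are determined by $E_0=I_d$ and $\mathrm{Exp}_G\circ\partial\rho(t)=\rho(t)\circ\mathrm{Exp}_G$ ($\partial\rho(t)$ being the constant term of $\rho(t)\in\mathrm{Mat}_d(\mathbb{K})[\tau]$). Put $\Theta=(\Phi'^{-1})^{\mathrm{tr}}$, let $X$ be the block diagonal $r\times d$ matrix with diagonal blocks $\mathbf{x}_i=\big((t-\theta)^{d_i-1},\dots,t-\theta,1\big)$, and let $D$ be the operator that sends an $r\times d$ matrix with rows $\mathbf{a}_1,\dots,\mathbf{a}_r$ to the $d\times d$ matrix with rows $\partial_t^{d_1-1}\mathbf{a}_1,\dots,\partial_t^{1}\mathbf{a}_1,\mathbf{a}_1,\dots,\partial_t^{d_r-1}\mathbf{a}_r,\dots,\partial_t^1\mathbf{a}_r,\mathbf{a}_r$. **Lemma.** Assume $\|Q_i\|_1\le q^{s_iq/(q-1)}$ for $1\le i\le r-1$, and let $\mathbf{c}=(c_{1,1},\dots,c_{1,d_1},\dots,c_{r,1},\dots,c_{r,d_r})^{\mathrm{tr}}\in\mathbb{C}_\infty^d$ satisfy $|c_{i,j}|_\infty<q^{\,j+d_i/(q-1)}$ for $1\le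 i\le r$, $1\le j\le d_i$. Then for every $n\ge0$ the entries of $D\big((\Theta^{(1)}\cdots\Theta^{(n)})X^{(n)}\big)$ lie in $\mathbb{T}_\theta$, the series $$\mathbf{Y}=\sum_{n=0}^{\infty}D\Big(\big(\Theta^{(1)}\Theta^{(2)}\cdots\Theta^{(n)}\big)X^{(n)}\Big)\Big|_{t=\theta}\,\mathbf{c}^{(n)}$$ converges in $\mathbb{C}_\infty^d$, the series $\mathrm{Exp}_G(\mathbf{Y})$ converges, and $$\mathrm{Exp}_G(\mathbf{Y})=\mathbf{c}.$$ -/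

import Mathlib

set_option linter.unusedSectionVars false

open Polynomial

namespace TMot

section Fields

/-! ### The field `ℂ_∞` -/

variable (Fq : Type*) [Field Fq] [Fintype Fq]

open scoped Classical in
/-- The absolute value `|x|_∞ = q ^ (-ord_∞ x) = q ^ (deg x)` on `K = 𝔽_q(θ)`. -/
noncomputable def absInfty : AbsoluteValue (RatFunc Fq) ℝ where
  toFun x := if x = 0 then 0 else (Fintype.card Fq : ℝ) ^ x.intDegree
  map_mul' x y := by
    have hq : (Fintype.card Fq : ℝ) ≠ 0 := by exact_mod_cast Fintype.card_ne_zero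
    by_cases hx : x = 0
    · simp [hx]
    by_cases hy : y = 0
    · simp [hy]
    simp [hx, hy, RatFunc.intDegree_mul hx hy, zpow_add₀ hq]
  nonneg' x := by split_ifs <;> positivity
  eq_zero' x := by
    have hq : (Fintype.card Fq : ℝ) ≠ 0 := by exact_mod_cast Fintype.card_ne_zero
    by_cases hx : x = 0
    · simp [hx]
    · simp [hx, zpow_ne_zero _ hq]
  add_le' x y := by
    have hq : (1 : ℝ) ≤ Fintype.card Fq := by exact_mod_cast Fintype.card_pos
    have h0 (z : RatFunc Fq) : (0 : ℝ) ≤ if z = 0 then 0 else (Fintype.card Fq : ℝ) ^ z.intDegree := by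
      split_ifs <;> positivity
    by_cases hx : x = 0
    · simp [hx]
    by_cases hy : y = 0
    · simp [hy]
    by_cases hxy : x + y = 0
    · simpa [hxy] using add_nonneg (h0 x) (h0 y)
    simp only [hx, hy, hxy, if_false]
    rcases le_max_iff.1 (RatFunc.intDegree_add_le hy hxy) with h | h
    · exact (zpow_le_zpow_right₀ hq h).trans (le_add_of_nonneg_right (by positivity))
    · exact (zpow_le_zpow_right₀ hq h).trans (le_add_of_nonneg_left (by positivity))

theorem absInfty_add_le_max (x y : RatFunc Fq) :
    absInfty Fq (x + y) ≤ max (absInfty Fq x) (absInfty Fq y) := by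
  classical
  have hq : (1 : ℝ) ≤ Fintype.card Fq := by exact_mod_cast Fintype.card_pos
  by_cases hx : x = 0
  · simp [hx]
  by_cases hy : y = 0
  · simp [hy]
  by_cases hxy : x + y = 0
  · simp [hxy]
  simp only [absInfty, AbsoluteValue.coe_mk, MulHom.coe_mk, hx, hy, hxy, if_false]
  rcases le_max_iff.1 (RatFunc.intDegree_add_le hy hxy) with h | h
  · exact le_max_of_le_left (zpow_le_zpow_right₀ hq h)
  · exact le_max_of_le_right (zpow_le_zpow_right₀ hq h)

theorem absInfty_X :
    absInfty Fq RatFunc.X = Fintype.card Fq := by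
  simp [absInfty, RatFunc.X_ne_zero]

/-- `K_∞ = 𝔽_q((1/θ))`, the completion of `K = 𝔽_q(θ)` at the infinite place. -/
abbrev KInfty := (absInfty Fq).Completion


instance KInfty.instUltra : IsUltrametricDist (KInfty Fq) := by
  apply IsUltrametricDist.isUltrametricDist_of_forall_norm_add_le_max_norm
  intro x y
  induction x, y using UniformSpace.Completion.induction_on₂ with
  | hp => exact isClosed_le (by fun_prop) (by fun_prop)
  | ih a b =>
    rw [← UniformSpace.Completion.coe_add]
    simp only [UniformSpace.Completion.norm_coe]
    exact absInfty_add_le_max Fq a.ofAbs b.ofAbs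

theorem KInfty.norm_algebraMap (x : RatFunc Fq) :
    ‖algebraMap (RatFunc Fq) (KInfty Fq) x‖ = absInfty Fq x := by
  change ‖((WithAbs.toAbs (absInfty Fq) x : WithAbs (absInfty Fq)) : KInfty Fq)‖ = _
  rw [UniformSpace.Completion.norm_coe]
  rfl
noncomputable instance : NontriviallyNormedField (KInfty Fq) where
  non_trivial := by
    refine ⟨algebraMap (RatFunc Fq) _ RatFunc.X, ?_⟩
    rw [KInfty.norm_algebraMap, absInfty_X]
    exact_mod_cast Fintype.one_lt_card

/-- An algebraic closure of `K_∞`. -/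
abbrev KInftyBar := AlgebraicClosure (KInfty Fq)

/-- The unique extension of `|·|_∞` to the algebraic closure of `K_∞`. -/
noncomputable instance : NormedField (KInftyBar Fq) :=
  spectralNorm.normedField (KInfty Fq) (KInftyBar Fq)
noncomputable instance : NormedAlgebra (KInfty Fq) (KInftyBar Fq) :=
  spectralNorm.normedAlgebra (KInfty Fq) (KInftyBar Fq)

/-- `ℂ_∞`, the completion of the algebraic closure of `K_∞`. -/
abbrev CInfty := UniformSpace.Completion (KInftyBar Fq)


noncomputable instance : Algebra (RatFunc Fq) (CInfty Fq) :=
  ((algebraMap (KInfty Fq) (CInfty Fq)).comp (algebraMap (RatFunc Fq) (KInfty Fq))).toAlgebra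

end Fields

section TModules

/-! ### `t`-modules and their exponential maps -/

variable (Fq : Type*) [Field Fq] [Fintype Fq] (F : Type*) [Field F] [Algebra (RatFunc Fq) F]

/-- `θ`, viewed in a field `F` containing `K = 𝔽_q(θ)`. -/
noncomputable def theta : F := algebraMap (RatFunc Fq) F RatFunc.X

theorem add_pow_card_pow (n : ℕ) (x y : F) :
    (x + y) ^ (Fintype.card Fq ^ n) = x ^ (Fintype.card Fq ^ n) + y ^ (Fintype.card Fq ^ n) := by
  obtain ⟨p, hp⟩ := CharP.exists Fq
  obtain ⟨m, hpp, hm⟩ := FiniteField.card Fq p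
  have : Fact p.Prime := ⟨hpp⟩
  have : CharP F p :=
    charP_of_injective_ringHom
      ((algebraMap (RatFunc Fq) F).comp (algebraMap Fq (RatFunc Fq))).injective p
  rw [hm, ← pow_mul, add_pow_char_pow]

/-- The `n`-fold Frobenius `x ↦ x ^ (q ^ n)`, for `n ≥ 0`. -/
def frob (n : ℕ) : F →+* F where
  toFun x := x ^ (Fintype.card Fq ^ n)
  map_one' := one_pow _
  map_mul' x y := mul_pow x y _
  map_zero' := zero_pow (pow_ne_zero _ Fintype.card_ne_zero)
  map_add' := add_pow_card_pow Fq F n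

@[simp] theorem frob_apply (n : ℕ) (x : F) : frob Fq F n x = x ^ (Fintype.card Fq ^ n) := rfl

/-- The automorphism `x ↦ x ^ q` of an algebraically closed field `F ⊇ K`. -/
noncomputable def frobEquiv [IsAlgClosed F] : F ≃+* F :=
  RingEquiv.ofBijective (frob Fq F 1) ⟨(frob Fq F 1).injective, fun y => by
    obtain ⟨z, hz⟩ := IsAlgClosed.exists_pow_nat_eq y (n := Fintype.card Fq) Fintype.card_pos
    exact ⟨z, by simpa using hz⟩⟩

theorem theta_pow_ne (n : ℕ) (hn : n ≠ 0) : theta Fq F ^ (Fintype.card Fq ^ n) ≠ theta Fq F := by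
  have h1 : 1 < Fintype.card Fq ^ n := Nat.one_lt_pow hn Fintype.one_lt_card
  intro h
  unfold theta at h
  rw [← map_pow] at h
  have h2 := (algebraMap (RatFunc Fq) F).injective h
  rw [← RatFunc.algebraMap_X, ← map_pow] at h2
  have h3 := RatFunc.algebraMap_injective Fq h2
  have := congrArg Polynomial.natDegree h3
  simp only [natDegree_X_pow, natDegree_X] at this
  omega

/-- A `t`-module over `F` with coordinates indexed by `n`. An `𝔽_q`-linear ring homomorphism
`ρ : 𝔽_q[t] → Mat_n(F)[τ]` is the same thing as its value `ρ(t) = ∑ᵢ αᵢ τ ^ i`, which is recorded by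
its coefficients `αᵢ`; the matrix `∂ρ(t) - θ` has to be nilpotent. -/
structure TModule (n : Type*) [Fintype n] [DecidableEq n] where
  /-- The coefficients of `ρ(t) ∈ Mat_n(F)[τ]`. -/
  rhoT : ℕ →₀ Matrix n n F
  nilpotent : IsNilpotent (rhoT 0 - theta Fq F • (1 : Matrix n n F))

namespace TModule
variable {Fq F} {n : Type*} [Fintype n] [DecidableEq n] (G : TModule Fq F n)

/-- The action of `ρ(t)` on the `F`-valued points: `z ↦ ∑ᵢ αᵢ z^{(i)}`. -/
def act (z : n → F) : n → F :=
  ∑ i ∈ G.rhoT.support, (G.rhoT i).mulVec fun l => z l ^ (Fintype.card Fq ^ i)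

/-- `e` is the sequence of coefficients of `Exp_G(z) = ∑ᵢ eᵢ z^{(i)}`: `e₀ = 1`, and the functional
equation `Exp_G ∘ ∂ρ(t) = ρ(t) ∘ Exp_G` holds as an identity of power series. (It then holds with
any `a ∈ 𝔽_q[t]` in place of `t`, as `t` generates `𝔽_q[t]` over `𝔽_q`.) -/
def IsExpCoeff (e : ℕ → Matrix n n F) : Prop :=
  e 0 = 1 ∧ ∀ m, e m * (G.rhoT 0).map (frob Fq F m) =
    ∑ i ∈ Finset.range (m + 1), G.rhoT i * (e (m - i)).map (frob Fq F i)

theorem sylvester_bijective (m : ℕ) (hm : m ≠ 0) : Function.Bijective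
    (fun E : Matrix n n F => E * (G.rhoT 0).map (frob Fq F m) - G.rhoT 0 * E) := by
  set A := G.rhoT 0 with hA
  set N := A - theta Fq F • (1 : Matrix n n F) with hN
  have hAN : A = theta Fq F • (1 : Matrix n n F) + N := by rw [hN]; abel
  have hNil : IsNilpotent N := G.nilpotent
  set f := frob Fq F m
  have hmap : A.map f = f (theta Fq F) • (1 : Matrix n n F) + N.map f := by
    rw [hAN, Matrix.map_add _ (map_add f)]
    congr 1
    ext i j
    by_cases h : i = j <;> simp [h]
  have hNil' : IsNilpotent (N.map f) := by
    have := hNil.map f.mapMatrix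
    simpa using this
  let L : Module.End F (Matrix n n F) := LinearMap.mulLeft F N
  let R : Module.End F (Matrix n n F) := LinearMap.mulRight F (N.map f)
  have hL : IsNilpotent L := (LinearMap.isNilpotent_mulLeft_iff F N).2 hNil
  have hR : IsNilpotent R := (LinearMap.isNilpotent_mulRight_iff F _).2 hNil'
  have hc : Commute R L := by
    show R * L = L * R
    ext1 x
    simp [L, R, mul_assoc]
  have hRL : IsNilpotent (R - L) := hc.isNilpotent_sub hR hL
  have hu : IsUnit (algebraMap F (Module.End F (Matrix n n F)) (f (theta Fq F) - theta Fq F)) :=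
    (IsUnit.mk0 _ (sub_ne_zero.2 (theta_pow_ne Fq F m hm))).map _
  have hU := hRL.isUnit_add_left_of_commute hu (Algebra.commutes _ _).symm
  have := (Module.End.isUnit_iff _).1 hU
  convert this using 1
  ext1 E
  rw [hmap]
  conv_lhs => rw [hAN]
  simp [L, R, mul_add, add_mul, Module.algebraMap_end_apply]
  abel

theorem isExpCoeff_iff_succ (e : ℕ → Matrix n n F) (m : ℕ) :
    (e m * (G.rhoT 0).map (frob Fq F m) =
      ∑ i ∈ Finset.range (m + 1), G.rhoT i * (e (m - i)).map (frob Fq F i)) ↔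
    e m * (G.rhoT 0).map (frob Fq F m) - G.rhoT 0 * e m =
      ∑ i : Fin m, G.rhoT (m - i) * (e i).map (frob Fq F (m - i)) := by
  have h1 : ∑ i ∈ Finset.range (m + 1), G.rhoT i * (e (m - i)).map (frob Fq F i) =
      (∑ i : Fin m, G.rhoT (m - i) * (e i).map (frob Fq F (m - i))) + G.rhoT 0 * e m := by
    rw [← Finset.sum_range_reflect, Finset.sum_range_succ,
      Fin.sum_univ_eq_sum_range (fun i => G.rhoT (m - i) * (e i).map (frob Fq F (m - i)))]
    congr 1
    · refine Finset.sum_congr rfl fun i hi => ?_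
      have hi' := Finset.mem_range.1 hi
      rw [show m + 1 - 1 - i = m - i by omega, show m - (m - i) = i by omega]
    rw [show m + 1 - 1 - m = 0 by omega, Nat.sub_zero]
    congr 1
    ext i j
    simp
  rw [h1, sub_eq_iff_eq_add]

theorem existsUnique_expCoeff : ∃! e : ℕ → Matrix n n F, G.IsExpCoeff e := by
  let S (m : ℕ) (E : Matrix n n F) := E * (G.rhoT 0).map (frob Fq F m) - G.rhoT 0 * E
  let step (m : ℕ) (prev : (k : ℕ) → k < m → Matrix n n F) : Matrix n n F :=
    if hm : m = 0 then 1 else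
      ((G.sylvester_bijective m hm).2
        (∑ i : Fin m, G.rhoT (m - i) * (prev i i.2).map (frob Fq F (m - i)))).choose
  let e : ℕ → Matrix n n F := WellFoundedLT.fix step
  have he (m : ℕ) : e m = step m (fun k _ => e k) := WellFoundedLT.fix_eq step m
  refine ⟨e, ⟨by rw [he]; simp [step], fun m => ?_⟩, fun e' he' => ?_⟩
  · by_cases hm : m = 0
    · subst hm
      have h0 : e 0 = 1 := by rw [he]; simp [step]
      rw [h0]
      simp only [zero_add, Finset.range_one, Finset.sum_singleton, Nat.sub_zero, h0, one_mul]
      ext i j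
      simp [Matrix.map_one]
    · rw [isExpCoeff_iff_succ G e m]
      have := ((G.sylvester_bijective m hm).2
        (∑ i : Fin m, G.rhoT (m - i) * (e i).map (frob Fq F (m - i)))).choose_spec
      have h2 : e m = ((G.sylvester_bijective m hm).2
        (∑ i : Fin m, G.rhoT (m - i) * (e i).map (frob Fq F (m - i)))).choose := by
        rw [he]; simp only [step, dif_neg hm]
      rw [h2]
      exact this
  · funext m
    induction m using Nat.strong_induction_on with
    | _ m ih =>
      by_cases hm : m = 0
      · subst hm
        rw [he'.1, he]; simp [step]
      · have h1 := (isExpCoeff_iff_succ G e' m).1 (he'.2 m)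
        have h2 := ((G.sylvester_bijective m hm).2
          (∑ i : Fin m, G.rhoT (m - i) * (e i).map (frob Fq F (m - i)))).choose_spec
        apply (G.sylvester_bijective m hm).1
        have h3 : e m = ((G.sylvester_bijective m hm).2
          (∑ i : Fin m, G.rhoT (m - i) * (e i).map (frob Fq F (m - i)))).choose := by
          rw [he]; simp only [step, dif_neg hm]
        rw [h3]
        refine h1.trans (Eq.trans ?_ h2.symm)
        exact Finset.sum_congr rfl fun i _ => by rw [ih i i.2]

/-- The coefficients `eᵢ` of the exponential map of `G`. -/
noncomputable def expCoeff : ℕ → Matrix n n F := G.existsUnique_expCoeff.choose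

theorem isExpCoeff_expCoeff : G.IsExpCoeff G.expCoeff := G.existsUnique_expCoeff.choose_spec.1

/-- The `i`-th term `eᵢ z^{(i)}` of the exponential series at `z ∈ Lie G(C)`, for `C ⊇ F`. -/
noncomputable def expTerm {C : Type*} [Field C] [Algebra F C] (z : n → C) (i : ℕ) : n → C :=
  ((G.expCoeff i).map (algebraMap F C)).mulVec fun l => z l ^ (Fintype.card Fq ^ i)

/-- The exponential map `Exp_G : Lie G(C) → G(C)`, `z ↦ ∑ᵢ eᵢ z^{(i)}`. -/
noncomputable def Exp {C : Type*} [Field C] [TopologicalSpace C] [Algebra F C] (z : n → C) :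
    n → C := ∑' i, G.expTerm z i

end TModule

section DualMotive

/-! ### The dual `t`-motive `M'` and its `t`-module

The depth is `r = k + 1`, and indices start at `0`. -/

variable [IsAlgClosed F] {k : ℕ} (s : Fin (k + 1) → ℕ+)

/-- `dᵢ = sᵢ + ⋯ + s_r`. -/
def dSum (i : Fin (k + 1)) : ℕ := ∑ j ∈ Finset.Ici i, (s j : ℕ)

theorem dSum_pos (i : Fin (k + 1)) : 0 < dSum s i :=
  Finset.sum_pos (fun j _ => (s j).pos) ⟨i, Finset.mem_Ici.2 le_rfl⟩

/-- The index set of the `d = d₁ + ⋯ + d_r` coordinates: the pair `⟨i, j⟩` stands for the coordinate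
`j + 1` of the block `i`. -/
abbrev Idx := Σ i : Fin (k + 1), Fin (dSum s i)

variable (Q : Fin k → F[X])

/-- The twist `f^{(-1)}` of a polynomial: `q`-th roots are taken of all its coefficients. -/
noncomputable def rootTwist (f : F[X]) : F[X] := f.map (frobEquiv Fq F).symm.toRingHom

/-- The matrix `Φ'`, with `(t - θ) ^ dᵢ` on the diagonal, `Qᵢ^{(-1)} (t - θ) ^ dᵢ` in row `i + 1` and
column `i`, and zeros elsewhere. -/
noncomputable def PhiPrime : Matrix (Fin (k + 1)) (Fin (k + 1)) F[X] := Matrix.of fun i j =>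
  if i = j then (X - C (theta Fq F)) ^ dSum s i
  else if h : (j : ℕ) + 1 = i then
    rootTwist Fq F (Q ⟨j, by omega⟩) * (X - C (theta Fq F)) ^ dSum s j
  else 0

/-- `σ` on `M' = Mat_{1 × r}(F[t])`, given by `σ a = a^{(-1)} Φ'`. -/
noncomputable def sigma (a : Fin (k + 1) → F[X]) : Fin (k + 1) → F[X] :=
  Matrix.vecMul (fun i => rootTwist Fq F (a i)) (PhiPrime Fq F s Q)

/-- The `F[σ]`-basis `(t - θ) ^ (dᵢ - 1) mᵢ, …, mᵢ` (`1 ≤ i ≤ r`) of `M'`. -/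
noncomputable def sigmaBasis (l : Idx s) : Fin (k + 1) → F[X] :=
  Pi.single l.1 ((X - C (theta Fq F)) ^ (dSum s l.1 - 1 - l.2))

/-- The element `∑ₗ bₗ eₗ` of `M'` for `b ∈ Mat_{1 × d}(F[σ])`; the entry `bₗ = ∑ₙ cₙ σ ^ n` is given
by its coefficients `cₙ`. -/
noncomputable def sigmaComb (b : Idx s → ℕ →₀ F) : Fin (k + 1) → F[X] :=
  ∑ l, (b l).sum fun n c => c • (sigma Fq F s Q)^[n] (sigmaBasis Fq F s l)

/-- `t - θ`. -/
noncomputable abbrev tSubTheta : F[X] := X - C (theta Fq F)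

/-- `Q_j^{(-1)}`, and `0` for the last index. -/
noncomputable def Qroot (j : Fin (k + 1)) : F[X] := 
  if h : (j : ℕ) < k then rootTwist Fq F (Q ⟨j, h⟩) else 0

/-- The entry after the `j`-th one, and `0` for the last index. -/
noncomputable def nextEntry {α} [Zero α] (a : Fin (k + 1) → α) (j : Fin (k + 1)) : α :=
  if h : (j : ℕ) < k then a ⟨j + 1, by omega⟩ else 0

theorem rootTwist_add (f g : F[X]) :
    rootTwist Fq F (f + g) = rootTwist Fq F f + rootTwist Fq F g := Polynomial.map_add _
theorem rootTwist_mul (f g : F[X]) :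
    rootTwist Fq F (f * g) = rootTwist Fq F f * rootTwist Fq F g := Polynomial.map_mul _
theorem rootTwist_injective : Function.Injective (rootTwist Fq F) :=
  Polynomial.map_injective _ (frobEquiv Fq F).symm.injective
theorem rootTwist_map (f : F[X]) :
    rootTwist Fq F (f.map (frobEquiv Fq F).toRingHom) = f := by
  ext n; simp [rootTwist]

theorem vecMul_PhiPrime (x : Fin (k + 1) → F[X]) (j : Fin (k + 1)) :
    Matrix.vecMul x (PhiPrime Fq F s Q) j = tSubTheta Fq F ^ dSum s j * (x j + Qroot Fq F Q j * nextEntry x j) := by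
  simp only [Matrix.vecMul, dotProduct, PhiPrime, Matrix.of_apply]
  by_cases hj : (j : ℕ) < k
  · have hne : j ≠ ⟨j + 1, by omega⟩ := fun h => by simp [Fin.ext_iff] at h
    rw [Finset.sum_eq_add j ⟨j + 1, by omega⟩ hne]
    · simp [hne.symm, Qroot, nextEntry, hj]; ring
    · intro c _ hc
      rw [if_neg hc.1, dif_neg, mul_zero]
      intro h
      exact hc.2 (Fin.ext h.symm)
    · simp
    · simp
  · rw [Finset.sum_eq_single j]
    · simp [Qroot, hj]; ring
    · intro c _ hc
      rw [if_neg hc, dif_neg, mul_zero]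
      omega
    · simp

theorem sigma_apply (a : Fin (k + 1) → F[X]) (j : Fin (k + 1)) :
    sigma Fq F s Q a j = tSubTheta Fq F ^ dSum s j *
      (rootTwist Fq F (a j) + Qroot Fq F Q j * nextEntry (fun i => rootTwist Fq F (a i)) j) :=
  vecMul_PhiPrime Fq F s Q _ j

theorem sigma_add (a b : Fin (k + 1) → F[X]) :
    sigma Fq F s Q (a + b) = sigma Fq F s Q a + sigma Fq F s Q b := by
  unfold sigma
  rw [← Matrix.add_vecMul]
  congr 1
  ext1 i
  exact rootTwist_add _ _ _ _

/-- `σ` as an additive map. -/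
noncomputable def sigmaHom : (Fin (k + 1) → F[X]) →+ (Fin (k + 1) → F[X]) :=
  AddMonoidHom.mk' (sigma Fq F s Q) (sigma_add Fq F s Q)

theorem sigma_smul (c : F) (a : Fin (k + 1) → F[X]) :
    sigma Fq F s Q (c • a) = (frobEquiv Fq F).symm c • sigma Fq F s Q a := by
  unfold sigma
  rw [← Matrix.smul_vecMul]
  congr 1
  ext1 i
  simp [rootTwist, Polynomial.smul_eq_C_mul]

theorem sigma_injective : Function.Injective (sigma Fq F s Q) := by
  rw [show sigma Fq F s Q = sigmaHom Fq F s Q from rfl, injective_iff_map_eq_zero]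
  intro a ha
  have h0 : ∀ j, rootTwist Fq F (a j) + Qroot Fq F Q j *
      nextEntry (fun i => rootTwist Fq F (a i)) j = 0 := fun j => by
    have := congrFun ha j
    rw [show sigmaHom Fq F s Q a = sigma Fq F s Q a from rfl, sigma_apply] at this
    exact (mul_eq_zero.1 this).resolve_left (pow_ne_zero _ (X_sub_C_ne_zero _))
  have h1 : ∀ j, rootTwist Fq F (a j) = 0 := by
    intro j
    induction j using Fin.reverseInduction with
    | last => simpa [Qroot] using h0 (Fin.last k)
    | cast i ih =>
      have := h0 i.castSucc
      have hn : nextEntry (fun i => rootTwist Fq F (a i)) i.castSucc = 0 := by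
        simp only [nextEntry, Fin.val_castSucc, i.2, dif_pos]
        exact ih
      rwa [hn, mul_zero, add_zero] at this
  funext j
  apply rootTwist_injective Fq F
  rw [h1 j]; simp [rootTwist]

theorem sigma_pow_smul (n : ℕ) (c : F) (a : Fin (k + 1) → F[X]) :
    sigma Fq F s Q (c • (sigma Fq F s Q)^[n] a) =
      (frobEquiv Fq F).symm c • (sigma Fq F s Q)^[n + 1] a := by
  rw [sigma_smul, Function.iterate_succ_apply']

theorem sigmaComb_add (b b' : Idx s → ℕ →₀ F) :
    sigmaComb Fq F s Q (b + b') = sigmaComb Fq F s Q b + sigmaComb Fq F s Q b' := by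
  unfold sigmaComb
  rw [← Finset.sum_add_distrib]
  refine Finset.sum_congr rfl fun l _ => ?_
  rw [Pi.add_apply, Finsupp.sum_add_index' (by simp) (fun n c c' => add_smul c c' _)]

/-- `sigmaComb` as an additive map. -/
noncomputable def sigmaCombHom : (Idx s → ℕ →₀ F) →+ (Fin (k + 1) → F[X]) :=
  AddMonoidHom.mk' (sigmaComb Fq F s Q) (sigmaComb_add Fq F s Q)

theorem sigmaComb_single (l : Idx s) (n : ℕ) (c : F) :
    sigmaComb Fq F s Q (Pi.single l (Finsupp.single n c)) =
      c • (sigma Fq F s Q)^[n] (sigmaBasis Fq F s l) := by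
  unfold sigmaComb
  rw [Finset.sum_eq_single l]
  · simp
  · intro l' _ h
    simp [Pi.single_eq_of_ne h]
  · simp

/-- The coefficients of `b'` in `b = b(0) + σ b'`. -/
noncomputable def shiftDown (b : Idx s → ℕ →₀ F) (l : Idx s) : ℕ →₀ F :=
  Finsupp.mapRange (frobEquiv Fq F) (map_zero _) (Finsupp.comapDomain Nat.succ (b l)
    Nat.succ_injective.injOn)

theorem sigmaComb_eq (b : Idx s → ℕ →₀ F) :
    sigmaComb Fq F s Q b = (∑ l, b l 0 • sigmaBasis Fq F s l) +
      sigma Fq F s Q (sigmaComb Fq F s Q (shiftDown Fq F s b)) := by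
  conv_rhs => rw [show sigma Fq F s Q = sigmaHom Fq F s Q from rfl]
  simp only [sigmaComb, map_sum]
  rw [← Finset.sum_add_distrib]
  refine Finset.sum_congr rfl fun l _ => ?_
  rw [Finsupp.sum_of_support_subset (s := Finset.range ((b l).support.sup id + 2)) _ _ _ (by simp)]
  · rw [Finset.sum_range_succ']
    rw [Finsupp.sum_of_support_subset (s := Finset.range ((b l).support.sup id + 1)) _ _ _ (by simp)]
    · rw [map_sum]
      refine (add_comm _ _).trans ?_
      congr 1
      refine Finset.sum_congr rfl fun n _ => ?_
      rw [show (sigmaHom Fq F s Q : _ → _) = sigma Fq F s Q from rfl, sigma_pow_smul]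
      simp [shiftDown]
    · intro n hn
      simp only [shiftDown, Finsupp.mem_support_iff, Finsupp.mapRange_apply,
        Finsupp.comapDomain_apply, ne_eq, EmbeddingLike.map_eq_zero_iff] at hn
      have := Finset.le_sup (f := id) (Finsupp.mem_support_iff.2 hn)
      simp only [id, Finset.mem_range] at *
      omega
  · intro n hn
    have := Finset.le_sup (f := id) hn
    simp only [id, Finset.mem_range] at *
    omega

theorem jet_eq_zero (d : ℕ) (c : Fin d → F)
    (h : tSubTheta Fq F ^ d ∣ ∑ j, c j • tSubTheta Fq F ^ (d - 1 - j)) : c = 0 := by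
  have hx : (∑ j, c j • (X : F[X]) ^ (d - 1 - j)).comp (tSubTheta Fq F) = ∑ j, c j • tSubTheta Fq F ^ (d - 1 - j) := by
    rw [Polynomial.sum_comp]
    simp
  have h0 : ∑ j, c j • tSubTheta Fq F ^ (d - 1 - j) = 0 := by
    by_contra hne
    have hd : (∑ j, c j • tSubTheta Fq F ^ (d - 1 - j)).degree < d := by
      refine (Polynomial.degree_sum_le _ _).trans_lt ?_
      refine (Finset.sup_lt_iff (WithBot.bot_lt_coe d)).2 ?_
      intro j _
      refine (Polynomial.degree_smul_le _ _).trans_lt ?_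
      rw [Polynomial.degree_pow, Polynomial.degree_X_sub_C, nsmul_one]
      have := j.2
      exact WithBot.coe_lt_coe.2 (by omega : d - 1 - (j : ℕ) < d)
    refine hne (Polynomial.eq_zero_of_dvd_of_degree_lt h ?_)
    rwa [Polynomial.degree_pow, Polynomial.degree_X_sub_C, nsmul_one]
  have h1 : (∑ j, c j • (X : F[X]) ^ (d - 1 - j)) = 0 := by
    rw [← hx] at h0
    have := congrArg (fun p => p.comp (X + C (theta Fq F))) h0
    simpa [Polynomial.comp_assoc] using this
  funext j
  have h2 := congrArg (fun p => p.coeff (d - 1 - j)) h1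
  simp only [finsetSum_coeff, coeff_smul, coeff_X_pow, coeff_zero] at h2
  rw [Finset.sum_eq_single j] at h2
  · simpa using h2
  · intro i _ hij
    rw [if_neg, smul_zero]
    intro h
    apply hij
    ext
    omega
  · simp

theorem dvd_sigma (a : Fin (k + 1) → F[X]) (i : Fin (k + 1)) :
    tSubTheta Fq F ^ dSum s i ∣ sigma Fq F s Q a i := by
  rw [sigma_apply]; exact dvd_mul_right _ _

theorem sum_sigmaBasis_apply (c : Idx s → F) (i : Fin (k + 1)) :
    (∑ l, c l • sigmaBasis Fq F s l) i = ∑ j : Fin (dSum s i), c ⟨i, j⟩ • tSubTheta Fq F ^ (dSum s i - 1 - j) := by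
  rw [Finset.sum_apply, Fintype.sum_sigma, Finset.sum_eq_single i]
  · simp [sigmaBasis]
  · intro i' _ h
    simp [sigmaBasis, Pi.single_eq_of_ne h.symm]
  · simp

theorem jets_eq_zero (c : Idx s → F)
    (h : ∀ i, tSubTheta Fq F ^ dSum s i ∣ (∑ l, c l • sigmaBasis Fq F s l) i) : c = 0 := by
  funext ⟨i, j⟩
  have := h i
  rw [sum_sigmaBasis_apply] at this
  exact congrFun (jet_eq_zero Fq F _ _ this) j

theorem sigmaComb_injective : Function.Injective (sigmaComb Fq F s Q) := by
  rw [show sigmaComb Fq F s Q = sigmaCombHom Fq F s Q from rfl, injective_iff_map_eq_zero]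
  intro b hb
  have key : ∀ (n : ℕ) (b : Idx s → ℕ →₀ F), sigmaComb Fq F s Q b = 0 → ∀ l, b l n = 0 := by
    intro n
    have h0 : ∀ (b : Idx s → ℕ →₀ F), sigmaComb Fq F s Q b = 0 → ∀ l, b l 0 = 0 := by
      intro b hb
      rw [sigmaComb_eq] at hb
      refine fun l => congrFun (jets_eq_zero Fq F s (fun l => b l 0) fun i => ?_) l
      rw [eq_neg_of_add_eq_zero_left hb]
      exact (dvd_sigma Fq F s Q _ i).neg_right
    induction n with
    | zero => exact h0
    | succ n ih =>
      intro b hb l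
      have h1 := h0 b hb
      rw [sigmaComb_eq] at hb
      simp only [h1, zero_smul, Finset.sum_const_zero, zero_add] at hb
      have h2 : sigmaComb Fq F s Q (shiftDown Fq F s b) = 0 := by
        apply sigma_injective Fq F s Q
        rw [hb]
        exact (map_zero (sigmaHom Fq F s Q)).symm
      simpa [shiftDown] using ih _ h2 l
  funext l
  ext n
  exact key n b hb l

theorem mem_range_sigma {x : Fin (k + 1) → F[X]} (hx : x ∈ (sigmaCombHom Fq F s Q).range) :
    sigma Fq F s Q x ∈ (sigmaCombHom Fq F s Q).range := by
  obtain ⟨b, rfl⟩ := hx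
  rw [show sigma Fq F s Q = sigmaHom Fq F s Q from rfl]
  change sigmaHom Fq F s Q (sigmaComb Fq F s Q b) ∈ _
  unfold sigmaComb
  rw [map_sum]
  refine sum_mem fun l _ => ?_
  rw [Finsupp.sum, map_sum]
  refine sum_mem fun n _ => ?_
  refine ⟨Pi.single l (Finsupp.single (n + 1) ((frobEquiv Fq F).symm (b l n))), ?_⟩
  change sigmaComb Fq F s Q _ = sigma Fq F s Q _
  rw [sigmaComb_single, sigma_pow_smul]

theorem sigmaComb_surjective : Function.Surjective (sigmaComb Fq F s Q) := by
  set S := (sigmaCombHom Fq F s Q).range with hS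
  have hjet : ∀ (i : Fin (k + 1)) (p : F[X]), p.degree < dSum s i → Pi.single i p ∈ S := by
    intro i p hp
    have hp' : p = ∑ j : Fin (dSum s i), ((p.comp (X + C (theta Fq F))).coeff (dSum s i - 1 - j)) •
        tSubTheta Fq F ^ (dSum s i - 1 - j) := by
      have hdeg : (p.comp (X + C (theta Fq F))).degree < dSum s i := by
        rwa [← Polynomial.taylor_apply, Polynomial.degree_taylor]
      have hnat : (p.comp (X + C (theta Fq F))).natDegree < dSum s i := by
        by_cases h0 : p.comp (X + C (theta Fq F)) = 0
        · rw [h0, natDegree_zero]; exact dSum_pos s i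
        · exact (Polynomial.natDegree_lt_iff_degree_lt h0).2 hdeg
      have h1 := Polynomial.as_sum_range' (p.comp (X + C (theta Fq F))) (dSum s i)
        hnat
      have h2 := congrArg (fun f => f.comp (tSubTheta Fq F)) h1
      simp only [Polynomial.comp_assoc] at h2
      rw [show (X + C (theta Fq F) : F[X]).comp (tSubTheta Fq F) = X by simp, Polynomial.comp_X] at h2
      rw [Fin.sum_univ_eq_sum_range (fun j => ((p.comp (X + C (theta Fq F))).coeff (dSum s i - 1 - j)) •
        tSubTheta Fq F ^ (dSum s i - 1 - j)), Finset.sum_range_reflect (fun j =>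
          ((p.comp (X + C (theta Fq F))).coeff j) • tSubTheta Fq F ^ j)]
      conv_lhs => rw [h2]
      rw [Polynomial.sum_comp]
      simp [← Polynomial.C_mul_X_pow_eq_monomial, Polynomial.smul_eq_C_mul]
    have : (Pi.single i p : Fin (k + 1) → F[X]) = ∑ j : Fin (dSum s i),
        ((p.comp (X + C (theta Fq F))).coeff (dSum s i - 1 - j)) • sigmaBasis Fq F s ⟨i, j⟩ := by
      conv_lhs => rw [hp']
      simp only [sigmaBasis]
      funext i'
      by_cases h : i' = i
      · subst h; simp
      · simp [Pi.single_eq_of_ne h]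
    rw [this]
    refine sum_mem fun j _ => ⟨Pi.single ⟨i, j⟩ (Finsupp.single 0
      ((p.comp (X + C (theta Fq F))).coeff (dSum s i - 1 - j))), ?_⟩
    exact sigmaComb_single Fq F s Q _ 0 _
  have key : ∀ (m : ℕ) (hm : m < k + 1) (p : F[X]), Pi.single (⟨m, hm⟩ : Fin (k + 1)) p ∈ S := by
    intro m
    induction m using Nat.strong_induction_on with
    | _ m ihm =>
    intro hm
    have : ∀ (N : ℕ) (p : F[X]), p.natDegree ≤ N → Pi.single (⟨m, hm⟩ : Fin (k + 1)) p ∈ S := by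
      intro N
      induction N using Nat.strong_induction_on with
      | _ N ihN =>
      intro p hp
      set i : Fin (k + 1) := ⟨m, hm⟩ with hi
      by_cases hdeg : p.degree < dSum s i
      · exact hjet i p hdeg
      have hmonic : (tSubTheta Fq F ^ dSum s i).Monic := (monic_X_sub_C _).pow _
      set b := p /ₘ (tSubTheta Fq F ^ dSum s i) with hb
      have hsplit : p = p %ₘ (tSubTheta Fq F ^ dSum s i) + tSubTheta Fq F ^ dSum s i * b :=
        (Polynomial.modByMonic_add_div p _).symm
      have hnd : (tSubTheta Fq F ^ dSum s i).natDegree = dSum s i := by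
        rw [Polynomial.natDegree_pow, Polynomial.natDegree_X_sub_C, mul_one]
      have hmod : (p %ₘ (tSubTheta Fq F ^ dSum s i)).degree < dSum s i := by
        have := Polynomial.degree_modByMonic_lt p hmonic
        rwa [Polynomial.degree_pow, Polynomial.degree_X_sub_C, nsmul_one] at this
      have hpd : dSum s i ≤ p.natDegree := by
        have h1 : p ≠ 0 := by
          rintro rfl
          exact hdeg (by simp)
        rw [not_lt, Polynomial.degree_eq_natDegree h1] at hdeg
        exact_mod_cast hdeg
      have hbdeg : b.natDegree < N := by
        rw [hb, Polynomial.natDegree_divByMonic p hmonic, hnd]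
        have := dSum_pos s i
        omega
      have hb1 : Pi.single i (b.map (frobEquiv Fq F).toRingHom) ∈ S :=
        ihN b.natDegree hbdeg _ Polynomial.natDegree_map_le
      have hσ := mem_range_sigma Fq F s Q hb1
      rw [hsplit, Pi.single_add]
      refine add_mem (hjet i _ hmod) ?_
      have hdiff : Pi.single i (tSubTheta Fq F ^ dSum s i * b) -
          sigma Fq F s Q (Pi.single i (b.map (frobEquiv Fq F).toRingHom)) ∈ S := by
        have hz : rootTwist Fq F (0 : F[X]) = 0 := by simp [rootTwist]
        by_cases hm0 : m = 0
        · convert zero_mem S using 1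
          funext j
          rw [Pi.sub_apply, Pi.zero_apply, sigma_apply]
          have hn : nextEntry (fun i' => rootTwist Fq F
              ((Pi.single i (b.map (frobEquiv Fq F).toRingHom) : Fin (k + 1) → F[X]) i')) j = 0 := by
            unfold nextEntry
            split_ifs with hjk
            · beta_reduce
              rw [Pi.single_eq_of_ne, hz]
              intro h
              have := congrArg Fin.val h
              simp [hi, hm0] at this
            · rfl
          rw [hn]
          by_cases hj : j = i
          · subst hj; rw [Pi.single_eq_same, Pi.single_eq_same, rootTwist_map]; simp
          · simp [Pi.single_eq_of_ne hj, hz]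
        · have hlt : m - 1 < k + 1 := by omega
          convert ihm (m - 1) (by omega) hlt (-(tSubTheta Fq F ^ dSum s ⟨m - 1, hlt⟩ *
            (Qroot Fq F Q ⟨m - 1, hlt⟩ * b))) using 1
          funext j
          rw [Pi.sub_apply, sigma_apply]
          by_cases hj1 : j = ⟨m - 1, hlt⟩
          · have hji : j ≠ i := by
              rw [hj1]; intro h; have := congrArg Fin.val h; simp [hi] at this; omega
            have hn : nextEntry (fun i' => rootTwist Fq F
                ((Pi.single i (b.map (frobEquiv Fq F).toRingHom) : Fin (k + 1) → F[X]) i')) j = b := by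
              have hjk : (j : ℕ) < k := by rw [hj1]; simp; omega
              rw [nextEntry, dif_pos hjk]
              have : (⟨(j : ℕ) + 1, by omega⟩ : Fin (k + 1)) = i := by
                ext; have := congrArg Fin.val hj1; simp [hi] at this ⊢; omega
              rw [this, Pi.single_eq_same, rootTwist_map]
            rw [hn, Pi.single_eq_of_ne hji, Pi.single_eq_of_ne hji, hz, hj1, Pi.single_eq_same]
            ring
          · have hn : nextEntry (fun i' => rootTwist Fq F
                ((Pi.single i (b.map (frobEquiv Fq F).toRingHom) : Fin (k + 1) → F[X]) i')) j = 0 := by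
              unfold nextEntry
              split_ifs with hjk
              · beta_reduce
                rw [Pi.single_eq_of_ne, hz]
                intro h
                apply hj1
                have := congrArg Fin.val h
                ext
                simp [hi] at this ⊢
                omega
              · rfl
            rw [hn, Pi.single_eq_of_ne hj1]
            by_cases hj : j = i
            · subst hj; rw [Pi.single_eq_same, Pi.single_eq_same, rootTwist_map]; simp
            · simp [Pi.single_eq_of_ne hj, hz]
      have := add_mem hdiff hσ
      simpa using this
    exact fun p => this p.natDegree p le_rfl
  intro a
  have ha : a ∈ S := by
    rw [← Finset.univ_sum_single a]
    exact sum_mem fun i _ => key i i.2 _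
  exact ha

/-- `ι : Mat_{1 × r}(F[t]) → Mat_{1 × d}(F[σ])`, the coordinates with respect to the `F[σ]`-basis. -/
noncomputable def iota : (Fin (k + 1) → F[X]) ≃ (Idx s → ℕ →₀ F) :=
  (Equiv.ofBijective (sigmaComb Fq F s Q)
    ⟨sigmaComb_injective Fq F s Q, sigmaComb_surjective Fq F s Q⟩).symm


theorem sigmaComb_iota (a : Fin (k + 1) → F[X]) :
    sigmaComb Fq F s Q (iota Fq F s Q a) = a :=
  (Equiv.ofBijective (sigmaComb Fq F s Q)
    ⟨sigmaComb_injective Fq F s Q, sigmaComb_surjective Fq F s Q⟩).apply_symm_apply a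

/-- `δ₀(∑ cᵢ σ ^ i) = c₀`. -/
def delta0 (b : Idx s → ℕ →₀ F) : Idx s → F := fun l => b l 0

/-- `δ₁(∑ cᵢ σ ^ i) = ∑ cᵢ^{(i)}`. -/
noncomputable def delta1 (b : Idx s → ℕ →₀ F) : Idx s → F :=
  fun l => (b l).sum fun n c => c ^ (Fintype.card Fq ^ n)

theorem iota_eq_iff {a : Fin (k + 1) → F[X]} {b : Idx s → ℕ →₀ F} :
    iota Fq F s Q a = b ↔ a = sigmaComb Fq F s Q b := by
  constructor
  · rintro rfl; exact (sigmaComb_iota _ _ _ _ _).symm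
  · rintro rfl; exact sigmaComb_injective Fq F s Q (sigmaComb_iota _ _ _ _ _)

theorem delta0_iota (a : Fin (k + 1) → F[X]) (c : Idx s → F)
    (h : ∀ i, tSubTheta Fq F ^ dSum s i ∣ a i - (∑ l, c l • sigmaBasis Fq F s l) i) :
    delta0 F s (iota Fq F s Q a) = c := by
  have h1 := sigmaComb_iota Fq F s Q a
  rw [sigmaComb_eq] at h1
  rw [← sub_eq_zero]
  refine jets_eq_zero Fq F s _ fun i => ?_
  have h2 := dvd_sub (h i) (dvd_sigma Fq F s Q
    (sigmaComb Fq F s Q (shiftDown Fq F s (iota Fq F s Q a))) i)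
  have h3 : (∑ l, (delta0 F s (iota Fq F s Q a) - c) l • sigmaBasis Fq F s l) i = a i -
      (∑ l, c l • sigmaBasis Fq F s l) i - sigma Fq F s Q
        (sigmaComb Fq F s Q (shiftDown Fq F s (iota Fq F s Q a))) i := by
    have h4 := congrFun h1 i
    rw [Pi.add_apply] at h4
    simp only [Pi.sub_apply, sub_smul, Finset.sum_sub_distrib, delta0]
    linear_combination h4
  rw [h3]
  exact h2

/-- The coefficients of `ρ(t)`: if `t eₘ = ∑ₗ ∑ₙ cₗₙ σ ^ n eₗ`, then the column `m` of the coefficient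
of `τ ^ n` has the entries `cₗₙ ^ (q ^ n)`. `Delta_X_smul` shows that this is the operator which
multiplication by `t` on `M' / (σ - 1) M'` induces on `F ^ d` through `Δ = δ₁ ∘ ι`. -/
noncomputable def rhoTCoeff (n : ℕ) : Matrix (Idx s) (Idx s) F := Matrix.of fun l m =>
  (iota Fq F s Q ((X : F[X]) • sigmaBasis Fq F s m) l n) ^ (Fintype.card Fq ^ n)

theorem rhoTCoeff_finite : (Function.support (rhoTCoeff Fq F s Q)).Finite := by
  refine Set.Finite.subset (Finset.finite_toSet (Finset.univ.biUnion fun lm : Idx s × Idx s =>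
    (iota Fq F s Q ((X : F[X]) • sigmaBasis Fq F s lm.2) lm.1).support)) ?_
  intro n hn
  by_contra h
  apply hn
  ext l m
  have : iota Fq F s Q ((X : F[X]) • sigmaBasis Fq F s m) l n = 0 := by
    by_contra h'
    exact h (by simpa using ⟨l.1, l.2, m.1, m.2, h'⟩)
  simp [rhoTCoeff, this]

theorem rhoTCoeff_zero (l m : Idx s) :
    (rhoTCoeff Fq F s Q 0 - theta Fq F • (1 : Matrix (Idx s) (Idx s) F)) l m =
      if l.1 = m.1 ∧ (l.2 : ℕ) + 1 = m.2 then 1 else 0 := by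
  have key := delta0_iota Fq F s Q ((X : F[X]) • sigmaBasis Fq F s m)
    (fun l => (if l = m then theta Fq F else 0) +
      if l.1 = m.1 ∧ (l.2 : ℕ) + 1 = m.2 then 1 else 0) ?_
  · have := congrFun key l
    simp only [delta0] at this
    simp only [Matrix.sub_apply, rhoTCoeff, Matrix.of_apply, pow_zero, pow_one, this,
      Matrix.smul_apply, Matrix.one_apply, smul_eq_mul, mul_ite, mul_one, mul_zero]
    ring
  · intro i
    obtain ⟨m1, m2⟩ := m
    simp only [add_smul, Finset.sum_add_distrib, ite_smul, zero_smul, one_smul,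
      Finset.sum_ite_eq', Finset.mem_univ, if_true, Pi.add_apply, Pi.smul_apply]
    rw [← sub_sub]
    have h1 : (X : F[X]) • sigmaBasis Fq F s ⟨m1, m2⟩ i - theta Fq F • sigmaBasis Fq F s ⟨m1, m2⟩ i =
        tSubTheta Fq F * sigmaBasis Fq F s ⟨m1, m2⟩ i := by
      rw [smul_eq_mul, Polynomial.smul_eq_C_mul]; ring
    rw [h1]
    rcases Nat.eq_zero_or_pos (m2 : ℕ) with h0 | h0
    · have : (∑ x : Idx s, if x.1 = m1 ∧ (x.2 : ℕ) + 1 = m2 then sigmaBasis Fq F s x else 0) = 0 := by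
        refine Finset.sum_eq_zero fun x _ => if_neg ?_
        omega
      rw [this, Pi.zero_apply, sub_zero]
      by_cases hi : i = m1
      · subst hi
        simp only [sigmaBasis, Pi.single_eq_same, h0]
        rw [← pow_succ']
        have := dSum_pos s i
        exact pow_dvd_pow _ (by omega)
      · simp [sigmaBasis, Pi.single_eq_of_ne hi]
    · have : (∑ x : Idx s, if x.1 = m1 ∧ (x.2 : ℕ) + 1 = m2 then sigmaBasis Fq F s x else 0) =
          sigmaBasis Fq F s ⟨m1, ⟨m2 - 1, by omega⟩⟩ := by
        rw [Finset.sum_eq_single (⟨m1, ⟨m2 - 1, by omega⟩⟩ : Idx s)]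
        · rw [if_pos]; exact ⟨rfl, by simp; omega⟩
        · rintro ⟨x1, x2⟩ _ hx
          refine if_neg ?_
          rintro ⟨hx1, hx2⟩
          dsimp only at hx1 hx2
          subst hx1
          apply hx
          congr 1
          ext
          simp; omega
        · simp
      rw [this]
      convert dvd_zero _
      rw [sub_eq_zero]
      by_cases hi : i = m1
      · subst hi
        simp only [sigmaBasis, Pi.single_eq_same]
        rw [← pow_succ']
        congr 1
        have := m2.2
        omega
      · simp [sigmaBasis, Pi.single_eq_of_ne hi]

/-- The `t`-module `G` associated to the dual `t`-motive `M'`. -/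
noncomputable def tModule : TModule Fq F (Idx s) where
  rhoT := Finsupp.ofSupportFinite (rhoTCoeff Fq F s Q) (rhoTCoeff_finite Fq F s Q)
  nilpotent := by
    rw [show Finsupp.ofSupportFinite (rhoTCoeff Fq F s Q) (rhoTCoeff_finite Fq F s Q) 0 =
      rhoTCoeff Fq F s Q 0 from rfl]
    set N := rhoTCoeff Fq F s Q 0 - theta Fq F • (1 : Matrix (Idx s) (Idx s) F) with hN
    have key : ∀ (n : ℕ) (l m : Idx s), (m.2 : ℕ) < n → (N ^ n) l m = 0 := by
      intro n
      induction n with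
      | zero => intro l m h; omega
      | succ n ih =>
        intro l m h
        rw [pow_succ, Matrix.mul_apply]
        refine Finset.sum_eq_zero fun x _ => ?_
        by_cases hx : x.1 = m.1 ∧ (x.2 : ℕ) + 1 = m.2
        · rw [ih l x (by omega), zero_mul]
        · rw [hN, rhoTCoeff_zero, if_neg hx, mul_zero]
    refine ⟨∑ i, dSum s i, ?_⟩
    ext l m
    refine key _ l m (lt_of_lt_of_le m.2.2 ?_)
    exact Finset.single_le_sum (f := dSum s) (fun _ _ => Nat.zero_le _) (Finset.mem_univ m.1)

/-- `Δ = δ₁ ∘ ι : M' → F ^ d`, which induces `M' / (σ - 1) M' ≅ F ^ d`. -/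
noncomputable def Delta (a : Fin (k + 1) → F[X]) : Idx s → F := delta1 Fq F s (iota Fq F s Q a)

theorem delta1_add (b b' : Idx s → ℕ →₀ F) :
    delta1 Fq F s (b + b') = delta1 Fq F s b + delta1 Fq F s b' := by
  funext l
  simp only [delta1, Pi.add_apply]
  exact Finsupp.sum_add_index' (fun n => (frob Fq F n).map_zero) (fun n => (frob Fq F n).map_add)

theorem Delta_add (a a' : Fin (k + 1) → F[X]) :
    Delta Fq F s Q (a + a') = Delta Fq F s Q a + Delta Fq F s Q a' := by
  unfold Delta
  rw [← delta1_add]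
  congr 1
  rw [iota_eq_iff, sigmaComb_add, sigmaComb_iota, sigmaComb_iota]

/-- `Δ` as an additive map. -/
noncomputable def DeltaHom : (Fin (k + 1) → F[X]) →+ (Idx s → F) :=
  AddMonoidHom.mk' (Delta Fq F s Q) (Delta_add Fq F s Q)

theorem Delta_smul_pow (n : ℕ) (c : F) (l : Idx s) :
    Delta Fq F s Q (c • (sigma Fq F s Q)^[n] (sigmaBasis Fq F s l)) =
      Pi.single l (c ^ (Fintype.card Fq ^ n)) := by
  have h : iota Fq F s Q (c • (sigma Fq F s Q)^[n] (sigmaBasis Fq F s l)) =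
      Pi.single l (Finsupp.single n c) := by
    rw [iota_eq_iff, sigmaComb_single]
  unfold Delta
  rw [h]
  funext l'
  by_cases hl : l' = l
  · subst hl
    simp only [delta1, Pi.single_eq_same]
    exact Finsupp.sum_single_index (frob Fq F n).map_zero
  · simp [delta1, Pi.single_eq_of_ne hl]

theorem frobEquiv_apply (x : F) : frobEquiv Fq F x = x ^ Fintype.card Fq := by
  change x ^ (Fintype.card Fq ^ 1) = _
  rw [pow_one]

theorem Delta_sigma (a : Fin (k + 1) → F[X]) :
    Delta Fq F s Q (sigma Fq F s Q a) = Delta Fq F s Q a := by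
  rw [← sigmaComb_iota Fq F s Q a]
  change DeltaHom Fq F s Q (sigmaHom Fq F s Q _) = DeltaHom Fq F s Q _
  simp only [sigmaComb, Finsupp.sum, map_sum]
  refine Finset.sum_congr rfl fun l _ => Finset.sum_congr rfl fun n _ => ?_
  change Delta Fq F s Q (sigma Fq F s Q _) = Delta Fq F s Q _
  rw [sigma_pow_smul, Delta_smul_pow, Delta_smul_pow, pow_succ', pow_mul,
    ← frobEquiv_apply, RingEquiv.apply_symm_apply]

theorem sigma_X_smul (a : Fin (k + 1) → F[X]) :
    sigma Fq F s Q ((X : F[X]) • a) = (X : F[X]) • sigma Fq F s Q a := by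
  unfold sigma
  rw [← Matrix.smul_vecMul]
  congr 1
  ext1 i
  simp [rootTwist]

theorem Delta_smul_iterate (n : ℕ) (c : F) (a : Fin (k + 1) → F[X]) :
    Delta Fq F s Q (c • (sigma Fq F s Q)^[n] a) =
      Delta Fq F s Q ((c ^ (Fintype.card Fq ^ n)) • a) := by
  induction n generalizing c with
  | zero => simp
  | succ n ih =>
    rw [pow_succ', pow_mul, ← ih, ← frobEquiv_apply,
      ← Delta_sigma Fq F s Q (frobEquiv Fq F c • _), sigma_pow_smul, RingEquiv.symm_apply_apply]

theorem sigma_iterate_X_smul (n : ℕ) (a : Fin (k + 1) → F[X]) :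
    (sigma Fq F s Q)^[n] ((X : F[X]) • a) = (X : F[X]) • (sigma Fq F s Q)^[n] a := by
  induction n with
  | zero => rfl
  | succ n ih => rw [Function.iterate_succ_apply', Function.iterate_succ_apply', ih, sigma_X_smul]

theorem Delta_smul_apply (z : F) (a : Fin (k + 1) → F[X]) (l : Idx s) :
    Delta Fq F s Q (z • a) l = (iota Fq F s Q a l).sum fun n c =>
      c ^ (Fintype.card Fq ^ n) * z ^ (Fintype.card Fq ^ n) := by
  have h : iota Fq F s Q (z • a) = fun l => z • iota Fq F s Q a l := by
    rw [iota_eq_iff]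
    conv_lhs => rw [← sigmaComb_iota Fq F s Q a]
    unfold sigmaComb
    rw [Finset.smul_sum]
    refine Finset.sum_congr rfl fun l _ => ?_
    rw [Finsupp.sum_smul_index (by simp), Finsupp.smul_sum]
    simp [mul_smul]
  rw [Delta, h, delta1, Finsupp.sum_smul_index
    (fun n => zero_pow (pow_ne_zero _ Fintype.card_ne_zero))]
  refine Finset.sum_congr rfl fun n _ => ?_
  beta_reduce
  rw [mul_pow, mul_comm]

theorem Delta_surjective : Function.Surjective (Delta Fq F s Q) := by
  intro z
  refine ⟨∑ l, z l • sigmaBasis Fq F s l, ?_⟩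
  change DeltaHom Fq F s Q _ = z
  rw [map_sum]
  have h (l : Idx s) : DeltaHom Fq F s Q (z l • sigmaBasis Fq F s l) = Pi.single l (z l) := by
    have := Delta_smul_pow Fq F s Q 0 (z l) l
    rwa [pow_zero, pow_one] at this
  simp only [h]
  exact Finset.univ_sum_single z

theorem Delta_X_smul (a : Fin (k + 1) → F[X]) :
    Delta Fq F s Q ((X : F[X]) • a) = (tModule Fq F s Q).act (Delta Fq F s Q a) := by
  have hbase (z : F) (l : Idx s) : Delta Fq F s Q (z • (X : F[X]) • sigmaBasis Fq F s l) =
      (tModule Fq F s Q).act (Pi.single l z) := by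
    funext m
    rw [Delta_smul_apply, TModule.act, Finset.sum_apply]
    have hsub : (iota Fq F s Q ((X : F[X]) • sigmaBasis Fq F s l) m).support ⊆
        (tModule Fq F s Q).rhoT.support := by
      intro n hn
      rw [Finsupp.mem_support_iff] at hn ⊢
      intro h0
      have := congrFun (congrFun h0 m) l
      exact hn (eq_zero_of_pow_eq_zero (by exact this))
    rw [Finsupp.sum_of_support_subset _ hsub]
    · refine Finset.sum_congr rfl fun n _ => ?_
      rw [Matrix.mulVec, dotProduct, Finset.sum_eq_single l]
      · rw [Pi.single_eq_same]; rfl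
      · intro l' _ hl
        rw [Pi.single_eq_of_ne hl, zero_pow (pow_ne_zero _ Fintype.card_ne_zero), mul_zero]
      · simp
    · intro n _
      rw [zero_pow (pow_ne_zero _ Fintype.card_ne_zero), zero_mul]
  let A : (Idx s → F) →+ (Idx s → F) := AddMonoidHom.mk' (tModule Fq F s Q).act fun x y => by
    simp only [TModule.act, Pi.add_apply, add_pow_card_pow Fq F]
    rw [← Finset.sum_add_distrib]
    exact Finset.sum_congr rfl fun n _ => Matrix.mulVec_add _ _ _
  change DeltaHom Fq F s Q _ = A (DeltaHom Fq F s Q _)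
  conv_lhs => rw [← sigmaComb_iota Fq F s Q a]
  conv_rhs => rw [← sigmaComb_iota Fq F s Q a]
  simp only [sigmaComb, Finsupp.sum, map_sum, Finset.smul_sum]
  refine Finset.sum_congr rfl fun l _ => Finset.sum_congr rfl fun n _ => ?_
  change Delta Fq F s Q _ = (tModule Fq F s Q).act (Delta Fq F s Q _)
  rw [Delta_smul_pow, ← hbase, smul_comm, ← sigma_iterate_X_smul, Delta_smul_iterate]

end DualMotive

/-! ### The series for the logarithm -/

section LogSeries

variable (C : Type*) [NormedField C] [Algebra (RatFunc Fq) C] [Algebra F C]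

/-- The inclusion `F[t] ⊆ C((t))`, for `F ⊆ C`. -/
noncomputable def toLaurent : F[X] →+* LaurentSeries C :=
  ((HahnSeries.ofPowerSeries ℤ C).comp Polynomial.coeToPowerSeries.ringHom).comp
    (Polynomial.mapRingHom (algebraMap F C))

/-- The twist `f^{(n)}` of a Laurent series, for `n ≥ 0`. -/
def laurentTwist (n : ℕ) (f : LaurentSeries C) : LaurentSeries C := f.map (frob Fq C n)

/-- The Laurent series `f` lies in the Tate algebra `𝕋_θ ⊆ C[[t]]`. -/
def InTate (f : LaurentSeries C) : Prop :=
  (∀ m < 0, f.coeff m = 0) ∧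
    Filter.Tendsto (fun m : ℕ => ‖f.coeff m * theta Fq C ^ m‖) Filter.atTop (nhds 0)

/-- The value `f|_{t = θ}` of `f ∈ 𝕋_θ`. -/
noncomputable def evalTheta (f : LaurentSeries C) : C := ∑' m : ℕ, f.coeff m * theta Fq C ^ m

variable [IsAlgClosed F] {k : ℕ} (s : Fin (k + 1) → ℕ+) (Q : Fin k → F[X])

/-- `Θ = (Φ'⁻¹)^tr`. -/
noncomputable def Theta : Matrix (Fin (k + 1)) (Fin (k + 1)) (LaurentSeries C) :=
  ((PhiPrime Fq F s Q).map (toLaurent F C))⁻¹.transpose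

/-- The block diagonal `r × d` matrix `X` with the rows `𝐱ᵢ = ((t - θ) ^ (dᵢ - 1), …, t - θ, 1)`. -/
noncomputable def XMat : Matrix (Fin (k + 1)) (Idx s) (LaurentSeries C) := Matrix.of fun i l =>
  if i = l.1 then toLaurent F C ((X - Polynomial.C (theta Fq F)) ^ (dSum s l.1 - 1 - l.2)) else 0

/-- The operator `D`, which replaces the row `i` by its hyperderivatives of the orders
`dᵢ - 1, …, 1, 0`. -/
noncomputable def DOp (B : Matrix (Fin (k + 1)) (Idx s) (LaurentSeries C)) :
    Matrix (Idx s) (Idx s) (LaurentSeries C) := Matrix.of fun l m =>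
  LaurentSeries.hasseDeriv C (dSum s l.1 - 1 - l.2) (B l.1 m)

/-- `D((Θ^{(1)} ⋯ Θ^{(n)}) X^{(n)})`. -/
noncomputable def logMatrix (n : ℕ) : Matrix (Idx s) (Idx s) (LaurentSeries C) :=
  DOp C s (((List.range n).map fun m => (Theta Fq F C s Q).map (laurentTwist Fq C (m + 1))).prod *
    (XMat Fq F C s).map (laurentTwist Fq C n))

/-- `D((Θ^{(1)} ⋯ Θ^{(n)}) X^{(n)})|_{t = θ} c^{(n)}`. -/
noncomputable def logTerm (c : Idx s → C) (n : ℕ) : Idx s → C :=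
  ((logMatrix Fq F C s Q n).map (evalTheta Fq C)).mulVec fun l => c l ^ (Fintype.card Fq ^ n)

end LogSeries
end TModules

end TMot

open Polynomial TMot

namespace TMot

/-! ### The norm on `ℂ_∞` -/

section CInfty

variable (Fq : Type*) [Field Fq] [Fintype Fq]

/-! Write `Ψ_n = Θ^{(1)} ⋯ Θ^{(n)}` and `P_n = D(Ψ_n X^{(n)})|_{t = θ}` (`logCoeff`). The series `P
= ∑ P_n τ^n` is the logarithm of `G`, and the bound on `c` places it in the domain of convergence.

Algebra. The columns of `P_n` are values of one additive map `jetVec n` on `M'`: it sends `a` to the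
Taylor coefficients at `t = θ` of `Ψ_n (a^{(n)})^tr`. Since `Θ` inverts `Φ'^tr`, the factor `Φ'`
brought in by `σ` cancels the last factor of `Ψ_{n+1}`, so `jetVec (n + 1) (σ a) = jetVec n a`. For
`n = 0` the value at `σ a` is `0`, because `(t - θ)^{d_i}` divides the `i`-th entry. Multiplication
by `t` acts on Taylor coefficients through `∂ρ(t)`. Expanding `t e_m` in the `σ`-basis then gives
`∂ρ(t) P = P ρ(t)` (`rhoT_zero_mul_logCoeff`). Together with `E ∂ρ(t) = ρ(t) E` this makes `E P`
commute with `ρ(t)`. Its constant term is `1`, and a Sylvester equation kills all higher terms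
(`skewMul_expC_eq_one`), so `E P = 1`.

Analysis. On the disc of radius `q^q = |θ^q|`, which contains `θ` and has no pole of `Θ^{(1)},
Θ^{(2)}, …` in its interior, the entries of `Θ^{(n+1)}` are bounded by quotients of weights. These
quotients telescope in the product `Ψ_n` (`gaussBound_psi`). The assumption on `‖Q_i‖₁` is what
makes the weights decrease fast enough, and the resulting bound on `P_n` yields `P_n c^{(n)} → 0` in
the stated range of `c` (`tendsto_norm_logCoeff_mul`). The Sylvester estimate also shows that
`Exp_G` is entire (`tendsto_norm_expC_mul`). The double series `E_i (P_j c^{(j)})^{(i)}` is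
therefore unconditionally summable: summed by rows it is `Exp_G(Y)`, summed by antidiagonals it is
`(E P)(c) = c`. -/

instance CInfty.instIsUltrametricDist : IsUltrametricDist (CInfty Fq) :=
  IsUltrametricDist.of_normedAlgebra (KInfty Fq)

theorem CInfty.norm_theta : ‖theta Fq (CInfty Fq)‖ = Fintype.card Fq := by
  change ‖algebraMap (KInfty Fq) (CInfty Fq) (algebraMap (RatFunc Fq) (KInfty Fq) RatFunc.X)‖ = _
  rw [norm_algebraMap', KInfty.norm_algebraMap, absInfty_X]

end CInfty

/-! ### Laurent series with bounded Gauss norm -/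

section GaussBound

variable {C : Type*} [NormedField C]

/-- `f` is a power series whose Gauss norm on the disc of radius `R` is at most `B`. -/
structure GaussBound (R B : ℝ) (f : LaurentSeries C) : Prop where
  coeff_neg : ∀ m < 0, f.coeff m = 0
  norm_le : ∀ m : ℕ, ‖f.coeff m‖ * R ^ m ≤ B

namespace GaussBound

variable {R B B' : ℝ} {f g : LaurentSeries C}

theorem mono (h : GaussBound R B f) (hB : B ≤ B') : GaussBound R B' f :=
  ⟨h.coeff_neg, fun m => (h.norm_le m).trans hB⟩

theorem bound_nonneg (h : GaussBound R B f) : 0 ≤ B := by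
  refine le_trans ?_ (h.norm_le 0)
  simp

theorem zero (hB : 0 ≤ B) : GaussBound R B (0 : LaurentSeries C) :=
  ⟨fun m _ => by simp, fun m => by simpa using hB⟩

theorem neg (h : GaussBound R B f) : GaussBound R B (-f) :=
  ⟨fun m hm => by simp [h.coeff_neg m hm], fun m => by simpa using h.norm_le m⟩

theorem single_zero (c : C) : GaussBound R ‖c‖ (HahnSeries.single (0 : ℤ) c) := by
  refine ⟨fun m hm => HahnSeries.coeff_single_of_ne hm.ne, fun m => ?_⟩
  rcases Nat.eq_zero_or_pos m with rfl | hm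
  · simp
  · rw [HahnSeries.coeff_single_of_ne (by omega)]
    simp

theorem one : GaussBound R 1 (1 : LaurentSeries C) := by
  simpa using single_zero (R := R) (1 : C)

variable [IsUltrametricDist C]

theorem add (hR : 0 < R) (hf : GaussBound R B f) (hg : GaussBound R B g) :
    GaussBound R B (f + g) := by
  refine ⟨fun m hm => by simp [hf.coeff_neg m hm, hg.coeff_neg m hm], fun m => ?_⟩
  have h1 := IsUltrametricDist.norm_add_le_max (f.coeff m) (g.coeff m)
  refine (mul_le_mul_of_nonneg_right h1 (pow_pos hR m).le).trans ?_
  rw [max_mul_of_nonneg _ _ (pow_pos hR m).le]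
  exact max_le (hf.norm_le m) (hg.norm_le m)

theorem sub (hR : 0 < R) (hf : GaussBound R B f) (hg : GaussBound R B g) :
    GaussBound R B (f - g) := by
  rw [sub_eq_add_neg]; exact hf.add hR hg.neg

theorem sum {ι : Type*} {S : Finset ι} {F : ι → LaurentSeries C} (hR : 0 < R) (hB : 0 ≤ B)
    (h : ∀ i ∈ S, GaussBound R B (F i)) : GaussBound R B (∑ i ∈ S, F i) :=
  Finset.sum_induction F (GaussBound R B) (fun _ _ => add hR) (zero hB) h

theorem mul (hR : 0 < R) (hf : GaussBound R B f) (hg : GaussBound R B' g) :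
    GaussBound R (B * B') (f * g) := by
  refine ⟨fun m hm => ?_, fun m => ?_⟩
  · rw [HahnSeries.coeff_mul]
    refine Finset.sum_eq_zero fun ij hij => ?_
    have h3 := (Finset.mem_antidiagonal.1 hij).2.2
    by_cases h : ij.1 < 0
    · rw [hf.coeff_neg _ h, zero_mul]
    · rw [hg.coeff_neg _ (by omega), mul_zero]
  · rw [HahnSeries.coeff_mul, ← le_div_iff₀ (pow_pos hR m)]
    refine IsUltrametricDist.norm_sum_le_of_forall_le_of_nonneg
      (div_nonneg (mul_nonneg hf.bound_nonneg hg.bound_nonneg) (pow_pos hR m).le)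
        fun ij hij => ?_
    obtain ⟨h1, h2, h3⟩ := Finset.mem_antidiagonal.1 hij
    have h1' : ¬ ij.1 < 0 := fun h => h1 (hf.coeff_neg _ h)
    have h2' : ¬ ij.2 < 0 := fun h => h2 (hg.coeff_neg _ h)
    obtain ⟨i, hi⟩ := Int.eq_ofNat_of_zero_le (not_lt.1 h1')
    obtain ⟨j, hj⟩ := Int.eq_ofNat_of_zero_le (not_lt.1 h2')
    rw [hi, hj] at h3
    have h4 : m = i + j := by exact_mod_cast h3.symm
    rw [le_div_iff₀ (pow_pos hR m), hi, hj, norm_mul, h4, pow_add]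
    calc _ = (‖f.coeff i‖ * R ^ i) * (‖g.coeff j‖ * R ^ j) := by ring
      _ ≤ _ := mul_le_mul (hf.norm_le i) (hg.norm_le j) (by positivity) hf.bound_nonneg

theorem pow (hR : 0 < R) (hf : GaussBound R B f) (n : ℕ) : GaussBound R (B ^ n) (f ^ n) := by
  induction n with
  | zero => simpa using one
  | succ n ih => rw [pow_succ, pow_succ]; exact ih.mul hR hf

/-- Binomial coefficients have norm at most `1` in an ultrametric field, and replacing `R ^ (m + a)`
by `R ^ m` costs nothing once `1 ≤ R`. -/
theorem hasseDeriv (hR : 1 ≤ R) (hf : GaussBound R B f) (a : ℕ) :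
    GaussBound R B (LaurentSeries.hasseDeriv C a f) := by
  refine ⟨fun m hm => ?_, fun m => ?_⟩
  · rw [LaurentSeries.hasseDeriv_coeff]
    by_cases h : m + a < 0
    · rw [hf.coeff_neg _ h, smul_zero]
    · obtain ⟨i, hi⟩ := Int.eq_ofNat_of_zero_le (not_lt.1 h)
      -- Here `0 ≤ m + a < a`, so the binomial coefficient vanishes and no negative powers appear.
      rw [hi, Ring.choose_natCast, Nat.choose_eq_zero_of_lt (by omega)]
      simp
  · rw [LaurentSeries.hasseDeriv_coeff, ← Nat.cast_add, Ring.choose_natCast]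
    refine le_trans ?_ (hf.norm_le (m + a))
    rw [zsmul_eq_mul, norm_mul, Int.cast_natCast]
    have h1 : ‖(((m + a).choose a : ℕ) : C)‖ ≤ 1 := IsUltrametricDist.norm_natCast_le_one C _
    refine mul_le_mul ?_ (pow_le_pow_right₀ hR (Nat.le_add_right _ _)) (by positivity)
      (norm_nonneg _)
    exact mul_le_of_le_one_left (norm_nonneg _) h1

end GaussBound

/-- The variable `t` of `C((t))`. -/
noncomputable def laurentT (C : Type*) [NormedField C] : LaurentSeries C :=
  HahnSeries.single (1 : ℤ) 1

theorem coeff_laurentT_mul (f : LaurentSeries C) (m : ℤ) :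
    (laurentT C * f).coeff m = f.coeff (m - 1) := by
  rw [laurentT, HahnSeries.coeff_single_mul, one_mul]

theorem gaussBound_laurentT {R : ℝ} (hR : 0 < R) : GaussBound R R (laurentT C) := by
  refine ⟨fun m hm => HahnSeries.coeff_single_of_ne (by omega), fun m => ?_⟩
  by_cases hm : m = 1
  · subst hm; simp [laurentT]
  · rw [laurentT, HahnSeries.coeff_single_of_ne (by omega)]
    simpa using hR.le

theorem hasseDeriv_laurentT_mul_zero (f : LaurentSeries C) :
    LaurentSeries.hasseDeriv C 0 (laurentT C * f) =
      laurentT C * LaurentSeries.hasseDeriv C 0 f := by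
  simp

/-- Leibniz rule for the factor `t`, whose hyperderivatives of order above `1` vanish; on
coefficients it is Pascal's rule. -/
theorem hasseDeriv_laurentT_mul_succ (a : ℕ) (f : LaurentSeries C) :
    LaurentSeries.hasseDeriv C (a + 1) (laurentT C * f) =
      laurentT C * LaurentSeries.hasseDeriv C (a + 1) f + LaurentSeries.hasseDeriv C a f := by
  ext m
  simp only [HahnSeries.coeff_add, coeff_laurentT_mul, LaurentSeries.hasseDeriv_coeff]
  rw [show m - 1 + ((a + 1 : ℕ) : ℤ) = m + a by push_cast; ring,
    show m + ((a + 1 : ℕ) : ℤ) - 1 = m + a by push_cast; ring,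
    show m + ((a + 1 : ℕ) : ℤ) = (m + a) + 1 by push_cast; ring,
    Ring.choose_succ_succ, add_smul, add_comm]

/-- The inverse of `t - α` has Gauss norm at most `|α|⁻¹` on a disc of radius `R ≤ |α|`. -/
theorem gaussBound_inv_laurentT_sub {R : ℝ} {α : C} (hR : 0 < R) (hα : R ≤ ‖α‖) :
    GaussBound R ‖α‖⁻¹ (laurentT C - HahnSeries.single 0 α)⁻¹ := by
  have h0 : α ≠ 0 := norm_pos_iff.1 (hR.trans_le hα)
  -- The geometric series `-∑ t^m / α^(m+1)`.
  set g : LaurentSeries C :=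
    -HahnSeries.ofPowerSeries ℤ C (PowerSeries.invUnitsSub (Units.mk0 α h0)) with hg
  have h1 : g * (laurentT C - HahnSeries.single 0 α) = 1 := by
    have := congrArg (HahnSeries.ofPowerSeries ℤ C)
      (PowerSeries.invUnitsSub_mul_sub (Units.mk0 α h0))
    rw [map_mul, map_sub, HahnSeries.ofPowerSeries_X, HahnSeries.ofPowerSeries_C,
      map_one (HahnSeries.ofPowerSeries ℤ C)] at this
    rw [← this, hg, laurentT]
    simp only [Units.val_mk0, HahnSeries.C_apply]
    ring
  rw [← eq_inv_of_mul_eq_one_left h1]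
  apply GaussBound.neg
  refine ⟨fun m hm => ?_, fun m => ?_⟩
  · rw [HahnSeries.ofPowerSeries_apply, HahnSeries.embDomain_of_notMem_range]
    rintro ⟨x, rfl⟩
    exact absurd hm (by simp)
  · rw [HahnSeries.ofPowerSeries_apply_coeff, PowerSeries.coeff_invUnitsSub, one_divp]
    simp only [Units.val_inv_eq_inv_val, Units.val_pow_eq_pow_val, Units.val_mk0, norm_inv,
      norm_pow]
    rw [pow_succ, mul_inv, mul_right_comm, ← inv_pow, ← mul_pow]
    refine mul_le_of_le_one_left (inv_nonneg.2 (norm_nonneg _)) (pow_le_one₀ (by positivity) ?_)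
    rw [inv_mul_le_iff₀ (hR.trans_le hα), mul_one]
    exact hα

/-! ### Evaluation and Taylor coefficients at `t = θ` -/

variable (Fq : Type*) [Field Fq] [Fintype Fq] [Algebra (RatFunc Fq) C]
  {R B : ℝ} {f g : LaurentSeries C}

/-- A bound on a disc strictly larger than `|θ|` forces geometric decay at `θ`; this is why the
estimates are made at a radius above `|θ|`. -/
theorem GaussBound.inTate (hf : GaussBound R B f) (hR : ‖theta Fq C‖ < R) : InTate Fq C f := by
  refine ⟨hf.coeff_neg, ?_⟩
  have hR0 : 0 < R := (norm_nonneg _).trans_lt hR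
  have h1 : Filter.Tendsto (fun m : ℕ => B * (‖theta Fq C‖ / R) ^ m) Filter.atTop (nhds 0) := by
    simpa using (tendsto_pow_atTop_nhds_zero_of_lt_one (by positivity)
      ((div_lt_one hR0).2 hR)).const_mul B
  refine squeeze_zero (fun _ => norm_nonneg _) (fun m => ?_) h1
  rw [norm_mul, norm_pow, div_pow, ← mul_div_assoc, le_div_iff₀ (pow_pos hR0 m)]
  calc _ = (‖f.coeff m‖ * R ^ m) * ‖theta Fq C‖ ^ m := by ring
    _ ≤ _ := mul_le_mul_of_nonneg_right (hf.norm_le m) (by positivity)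

variable [IsUltrametricDist C]

theorem GaussBound.norm_evalTheta_le (hf : GaussBound R B f) (hR : ‖theta Fq C‖ < R) :
    ‖evalTheta Fq C f‖ ≤ B := by
  refine IsUltrametricDist.norm_tsum_le_of_forall_le_of_nonneg hf.bound_nonneg fun m => ?_
  rw [norm_mul, norm_pow]
  refine le_trans ?_ (hf.norm_le m)
  gcongr

variable [CompleteSpace C]

theorem GaussBound.summable (hf : GaussBound R B f) (hR : ‖theta Fq C‖ < R) :
    Summable fun m : ℕ => f.coeff m * theta Fq C ^ m := by
  apply NonarchimedeanAddGroup.summable_of_tendsto_cofinite_zero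
  rw [Nat.cofinite_eq_atTop]
  exact tendsto_zero_iff_norm_tendsto_zero.2 (hf.inTate Fq hR).2

/-- The value at `t = θ` of the hyperderivative of order `a`. -/
noncomputable def jet (a : ℕ) (f : LaurentSeries C) : C :=
  evalTheta Fq C (LaurentSeries.hasseDeriv C a f)

theorem evalTheta_add (hf : GaussBound R B f) {B' : ℝ} (hg : GaussBound R B' g)
    (hR : ‖theta Fq C‖ < R) :
    evalTheta Fq C (f + g) = evalTheta Fq C f + evalTheta Fq C g := by
  unfold evalTheta
  rw [← (hf.summable Fq hR).tsum_add (hg.summable Fq hR)]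
  simp [add_mul]

theorem evalTheta_single_zero_mul (c : C) (f : LaurentSeries C) :
    evalTheta Fq C (HahnSeries.single 0 c * f) = c * evalTheta Fq C f := by
  unfold evalTheta
  rw [← tsum_mul_left]
  simp [mul_assoc]

theorem evalTheta_laurentT_mul (hf : GaussBound R B f) (hR : ‖theta Fq C‖ < R) :
    evalTheta Fq C (laurentT C * f) = theta Fq C * evalTheta Fq C f := by
  have hR0 : 0 < R := (norm_nonneg _).trans_lt hR
  unfold evalTheta
  rw [(((gaussBound_laurentT hR0).mul hR0 hf).summable Fq hR).tsum_eq_zero_add, ← tsum_mul_left]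
  simp only [coeff_laurentT_mul]
  rw [hf.coeff_neg _ (by simp), zero_mul, zero_add]
  congr 1
  ext m
  push_cast
  rw [add_sub_cancel_right, pow_succ]
  ring

theorem norm_jet_le (hR1 : 1 ≤ R) (hR : ‖theta Fq C‖ < R) (hf : GaussBound R B f)
    (a : ℕ) : ‖jet Fq a f‖ ≤ B :=
  (hf.hasseDeriv hR1 a).norm_evalTheta_le Fq hR

theorem jet_add (hR1 : 1 ≤ R) (hR : ‖theta Fq C‖ < R) (hf : GaussBound R B f)
    {B' : ℝ} (hg : GaussBound R B' g) (a : ℕ) :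
    jet Fq a (f + g) = jet Fq a f + jet Fq a g := by
  unfold jet
  rw [map_add]
  exact evalTheta_add Fq (hf.hasseDeriv hR1 a) (hg.hasseDeriv hR1 a) hR

theorem jet_single_zero_mul (c : C) (f : LaurentSeries C) (a : ℕ) :
    jet Fq a (HahnSeries.single 0 c * f) = c * jet Fq a f := by
  unfold jet
  rw [← evalTheta_single_zero_mul]
  congr 1
  ext m
  simp

theorem jet_zero_laurentT_mul (hR1 : 1 ≤ R) (hR : ‖theta Fq C‖ < R) (hf : GaussBound R B f) :
    jet Fq 0 (laurentT C * f) = theta Fq C * jet Fq 0 f := by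
  unfold jet
  rw [hasseDeriv_laurentT_mul_zero]
  exact evalTheta_laurentT_mul Fq (hf.hasseDeriv hR1 0) hR

theorem jet_succ_laurentT_mul (hR1 : 1 ≤ R) (hR : ‖theta Fq C‖ < R) (hf : GaussBound R B f)
    (a : ℕ) : jet Fq (a + 1) (laurentT C * f) = theta Fq C * jet Fq (a + 1) f + jet Fq a f := by
  have hR0 : 0 < R := zero_lt_one.trans_le hR1
  unfold jet
  rw [hasseDeriv_laurentT_mul_succ, evalTheta_add Fq
    ((gaussBound_laurentT hR0).mul hR0 (hf.hasseDeriv hR1 (a + 1))) (hf.hasseDeriv hR1 a) hR,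
    evalTheta_laurentT_mul Fq (hf.hasseDeriv hR1 (a + 1)) hR]

theorem jet_zero_sub_theta_mul (hR1 : 1 ≤ R) (hR : ‖theta Fq C‖ < R) (hf : GaussBound R B f) :
    jet Fq 0 ((laurentT C - HahnSeries.single 0 (theta Fq C)) * f) = 0 := by
  have hR0 : 0 < R := zero_lt_one.trans_le hR1
  rw [show (laurentT C - HahnSeries.single 0 (theta Fq C)) * f =
    laurentT C * f + HahnSeries.single 0 (-theta Fq C) * f by rw [HahnSeries.single_neg]; ring,
    jet_add Fq hR1 hR ((gaussBound_laurentT hR0).mul hR0 hf)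
      ((GaussBound.single_zero (-theta Fq C)).mul hR0 hf),
    jet_single_zero_mul, jet_zero_laurentT_mul Fq hR1 hR hf]
  ring

/-- Multiplication by `t - θ` shifts the Taylor expansion at `θ` by one place: the contribution of
`t` proportional to `θ` cancels. -/
theorem jet_succ_sub_theta_mul (hR1 : 1 ≤ R) (hR : ‖theta Fq C‖ < R) (hf : GaussBound R B f)
    (a : ℕ) :
    jet Fq (a + 1) ((laurentT C - HahnSeries.single 0 (theta Fq C)) * f) = jet Fq a f := by
  have hR0 : 0 < R := zero_lt_one.trans_le hR1
  rw [show (laurentT C - HahnSeries.single 0 (theta Fq C)) * f =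
    laurentT C * f + HahnSeries.single 0 (-theta Fq C) * f by rw [HahnSeries.single_neg]; ring,
    jet_add Fq hR1 hR ((gaussBound_laurentT hR0).mul hR0 hf)
      ((GaussBound.single_zero (-theta Fq C)).mul hR0 hf),
    jet_single_zero_mul, jet_succ_laurentT_mul Fq hR1 hR hf]
  ring

theorem gaussBound_sub_theta (hR1 : 1 ≤ R) (hR : ‖theta Fq C‖ < R) :
    GaussBound R R (laurentT C - HahnSeries.single 0 (theta Fq C)) :=
  (gaussBound_laurentT (zero_lt_one.trans_le hR1)).sub (zero_lt_one.trans_le hR1)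
    ((GaussBound.single_zero _).mono hR.le)

/-- A zero of order `d` at `θ` has no Taylor coefficients below `d`. Applied to the entries of `σ
a`, it makes the map for `n = 0` vanish on `σ M'`. -/
theorem jet_sub_theta_pow_mul (hR1 : 1 ≤ R) (hR : ‖theta Fq C‖ < R) (hf : GaussBound R B f)
    {a d : ℕ} (ha : a < d) :
    jet Fq a ((laurentT C - HahnSeries.single 0 (theta Fq C)) ^ d * f) = 0 := by
  have hR0 : 0 < R := zero_lt_one.trans_le hR1
  induction d generalizing a with
  | zero => omega
  | succ d ih =>
    have hg := ((gaussBound_sub_theta Fq hR1 hR).pow hR0 d).mul hR0 hf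
    rw [pow_succ', mul_assoc]
    cases a with
    | zero => exact jet_zero_sub_theta_mul Fq hR1 hR hg
    | succ a => rw [jet_succ_sub_theta_mul Fq hR1 hR hg, ih (a := a) (by omega)]

theorem jet_one (a : ℕ) : jet Fq a (1 : LaurentSeries C) = if a = 0 then 1 else 0 := by
  unfold jet evalTheta
  rw [tsum_eq_single 0]
  · rw [LaurentSeries.hasseDeriv_coeff]
    split_ifs with h
    · subst h; simp
    · rw [HahnSeries.coeff_one, if_neg (by simpa using h)]
      simp
  · intro m hm
    rw [LaurentSeries.hasseDeriv_coeff, HahnSeries.coeff_one, if_neg (by omega)]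
    simp

theorem jet_sub_theta_pow (hR1 : 1 ≤ R) (hR : ‖theta Fq C‖ < R) (a d : ℕ) :
    jet Fq a ((laurentT C - HahnSeries.single 0 (theta Fq C)) ^ d) = if a = d then 1 else 0 := by
  have hR0 : 0 < R := zero_lt_one.trans_le hR1
  induction d generalizing a with
  | zero => rw [pow_zero, jet_one]
  | succ d ih =>
    have hg := (gaussBound_sub_theta Fq hR1 hR).pow hR0 d
    rw [pow_succ']
    cases a with
    | zero => rw [jet_zero_sub_theta_mul Fq hR1 hR hg]; simp
    | succ a => rw [jet_succ_sub_theta_mul Fq hR1 hR hg, ih]; simp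

end GaussBound

/-! ### Twists of Laurent series and polynomials -/

section Twist

variable (Fq : Type*) [Field Fq] [Fintype Fq] (F : Type*) [Field F] [Algebra (RatFunc Fq) F]
  (C : Type*) [NormedField C] [Algebra (RatFunc Fq) C] [Algebra F C]

/-- The twist `f ↦ f^{(n)}` as a ring endomorphism of `C((t))`. -/
def laurentTwistHom (n : ℕ) : LaurentSeries C →+* LaurentSeries C where
  toFun := laurentTwist Fq C n
  map_one' := HahnSeries.map_one (frob Fq C n).toMonoidWithZeroHom
  map_mul' _ _ := HahnSeries.map_mul (frob Fq C n : C →ₙ+* C)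
  map_zero' := HahnSeries.map_zero (frob Fq C n : ZeroHom C C)
  map_add' _ _ := HahnSeries.map_add (frob Fq C n : C →+ C)

/-- The map `f ↦ f^{(n)}` from `F[t]` to `C((t))`. -/
noncomputable def polyTwist (n : ℕ) : F[X] →+* LaurentSeries C :=
  (laurentTwistHom Fq C n).comp (toLaurent F C)

theorem polyTwist_apply (n : ℕ) (p : F[X]) :
    polyTwist Fq F C n p = laurentTwist Fq C n (toLaurent F C p) := rfl

theorem coeff_polyTwist (n : ℕ) (p : F[X]) (m : ℕ) :
    (polyTwist Fq F C n p).coeff m = algebraMap F C (p.coeff m) ^ (Fintype.card Fq ^ n) := by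
  rw [polyTwist_apply, laurentTwist, HahnSeries.map_coeff, toLaurent]
  simp only [RingHom.comp_apply]
  rw [HahnSeries.ofPowerSeries_apply_coeff]
  simp [Polynomial.coeToPowerSeries.ringHom]

theorem coeff_polyTwist_neg (n : ℕ) (p : F[X]) (m : ℤ) (hm : m < 0) :
    (polyTwist Fq F C n p).coeff m = 0 := by
  rw [polyTwist_apply, laurentTwist, HahnSeries.map_coeff, toLaurent]
  simp only [RingHom.comp_apply]
  rw [HahnSeries.ofPowerSeries_apply, HahnSeries.embDomain_of_notMem_range, map_zero]
  rintro ⟨x, rfl⟩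
  exact absurd hm (by simp)

theorem polyTwist_ext {n : ℕ} {p : F[X]} {f : LaurentSeries C} (hf : ∀ m < 0, f.coeff m = 0)
    (h : ∀ m : ℕ, algebraMap F C (p.coeff m) ^ (Fintype.card Fq ^ n) = f.coeff m) :
    polyTwist Fq F C n p = f := by
  ext m
  by_cases hm : m < 0
  · rw [hf m hm, coeff_polyTwist_neg Fq F C n p m hm]
  · obtain ⟨i, rfl⟩ := Int.eq_ofNat_of_zero_le (not_lt.1 hm)
    exact (coeff_polyTwist Fq F C n p i).trans (h i)

theorem polyTwist_X (n : ℕ) : polyTwist Fq F C n X = laurentT C := by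
  have hq : Fintype.card Fq ^ n ≠ 0 := pow_ne_zero _ Fintype.card_ne_zero
  refine polyTwist_ext Fq F C (fun m hm => HahnSeries.coeff_single_of_ne (by omega)) fun m => ?_
  by_cases hm : m = 1
  · subst hm; simp [laurentT]
  · rw [laurentT, HahnSeries.coeff_single_of_ne (by omega), Polynomial.coeff_X_of_ne_one hm,
      map_zero, zero_pow hq]

theorem polyTwist_C (n : ℕ) (x : F) : polyTwist Fq F C n (Polynomial.C x) =
    HahnSeries.single 0 (algebraMap F C x ^ (Fintype.card Fq ^ n)) := by
  have hq : Fintype.card Fq ^ n ≠ 0 := pow_ne_zero _ Fintype.card_ne_zero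
  refine polyTwist_ext Fq F C (fun m hm => HahnSeries.coeff_single_of_ne (by omega)) fun m => ?_
  by_cases hm : m = 0
  · subst hm; simp
  · rw [HahnSeries.coeff_single_of_ne (by omega), Polynomial.coeff_C_of_ne_zero hm,
      map_zero, zero_pow hq]

theorem algebraMap_theta [IsScalarTower (RatFunc Fq) F C] :
    algebraMap F C (theta Fq F) = theta Fq C :=
  (IsScalarTower.algebraMap_apply (RatFunc Fq) F C _).symm

theorem polyTwist_tSubTheta [IsScalarTower (RatFunc Fq) F C] (n : ℕ) :
    polyTwist Fq F C n (tSubTheta Fq F) =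
      laurentT C - HahnSeries.single 0 (theta Fq C ^ (Fintype.card Fq ^ n)) := by
  rw [tSubTheta, map_sub, polyTwist_X, polyTwist_C, algebraMap_theta]

/-- The `q`-th roots in `Φ'` and in `σ` are undone by one positive twist, so Laurent series over `C`
only ever need nonnegative twists. -/
theorem polyTwist_succ_rootTwist [IsAlgClosed F] (n : ℕ) (p : F[X]) :
    polyTwist Fq F C (n + 1) (rootTwist Fq F p) = polyTwist Fq F C n p := by
  refine polyTwist_ext Fq F C (coeff_polyTwist_neg Fq F C n p) fun m => ?_
  rw [coeff_polyTwist, rootTwist, Polynomial.coeff_map, pow_succ', pow_mul, ← map_pow]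
  congr 2
  exact (frobEquiv_apply Fq F _).symm.trans ((frobEquiv Fq F).apply_symm_apply _)

/-- Twisting raises the coefficients to the power `q ^ n` but keeps the degree, so the factor coming
from `R` does not depend on `n`. -/
theorem gaussBound_polyTwist {R b : ℝ} (hR : 1 ≤ R) (n : ℕ) (p : F[X]) (hb : 0 ≤ b)
    (h : ∀ m, ‖algebraMap F C (p.coeff m)‖ ≤ b) :
    GaussBound R (b ^ (Fintype.card Fq ^ n) * R ^ p.natDegree) (polyTwist Fq F C n p) := by
  have hq : Fintype.card Fq ^ n ≠ 0 := pow_ne_zero _ Fintype.card_ne_zero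
  refine ⟨coeff_polyTwist_neg Fq F C n p, fun m => ?_⟩
  rw [coeff_polyTwist, norm_pow]
  by_cases hm : m ≤ p.natDegree
  · exact mul_le_mul (pow_le_pow_left₀ (norm_nonneg _) (h m) _) (pow_le_pow_right₀ hR hm)
      (by positivity) (by positivity)
  · rw [Polynomial.coeff_eq_zero_of_natDegree_lt (not_le.1 hm), map_zero, norm_zero, zero_pow hq,
      zero_mul]
    positivity

theorem exists_gaussBound_polyTwist {R : ℝ} (hR : 1 ≤ R) (n : ℕ) (p : F[X]) :
    ∃ B, GaussBound R B (polyTwist Fq F C n p) := by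
  refine ⟨_, gaussBound_polyTwist Fq F C hR n p (b := ∑ m ∈ p.support, ‖algebraMap F C (p.coeff m)‖)
    (Finset.sum_nonneg fun _ _ => norm_nonneg _) fun m => ?_⟩
  by_cases hm : m ∈ p.support
  · exact Finset.single_le_sum (f := fun m => ‖algebraMap F C (p.coeff m)‖)
      (fun _ _ => norm_nonneg _) hm
  · rw [Polynomial.notMem_support_iff.1 hm, map_zero, norm_zero]
    exact Finset.sum_nonneg fun _ _ => norm_nonneg _

end Twist

/-! ### The matrices `Θ^{(1)} ⋯ Θ^{(n)}` -/

section Psi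

variable (Fq : Type*) [Field Fq] [Fintype Fq] (F : Type*) [Field F] [Algebra (RatFunc Fq) F]
  (C : Type*) [NormedField C] [Algebra (RatFunc Fq) C] [Algebra F C]
  [IsAlgClosed F] {k : ℕ} (s : Fin (k + 1) → ℕ+) (Q : Fin k → F[X])

theorem det_PhiPrime_ne_zero : (PhiPrime Fq F s Q).det ≠ 0 := by
  rw [Matrix.det_of_isLowerTriangular]
  · refine Finset.prod_ne_zero_iff.2 fun i _ => ?_
    simp only [PhiPrime, Matrix.of_apply, if_true]
    exact pow_ne_zero _ (X_sub_C_ne_zero _)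
  · intro i j hij
    have hij' : i < j := hij
    simp only [PhiPrime, Matrix.of_apply]
    rw [if_neg hij'.ne, dif_neg]
    have := Fin.lt_def.1 hij'
    omega

theorem toLaurent_injective : Function.Injective (toLaurent F C) := by
  unfold toLaurent
  refine (HahnSeries.ofPowerSeries_injective.comp (Polynomial.coe_injective C)).comp ?_
  exact Polynomial.map_injective _ (algebraMap F C).injective

/-- `Θ^{(n)}`. -/
noncomputable def thetaTwist (n : ℕ) : Matrix (Fin (k + 1)) (Fin (k + 1)) (LaurentSeries C) :=
  (Theta Fq F C s Q).map (laurentTwist Fq C n)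

theorem thetaTwist_mul (n : ℕ) :
    thetaTwist Fq F C s Q n * ((PhiPrime Fq F s Q).map (polyTwist Fq F C n)).transpose = 1 := by
  have h0 : Theta Fq F C s Q * ((PhiPrime Fq F s Q).map (toLaurent F C)).transpose = 1 := by
    rw [Theta, ← Matrix.transpose_mul, Matrix.mul_nonsing_inv, Matrix.transpose_one]
    rw [show (PhiPrime Fq F s Q).map (toLaurent F C) =
      (toLaurent F C).mapMatrix (PhiPrime Fq F s Q) from rfl, ← RingHom.map_det]
    exact IsUnit.mk0 _ ((map_ne_zero_iff _ (toLaurent_injective F C)).2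
      (det_PhiPrime_ne_zero Fq F s Q))
  have h1 := congrArg (laurentTwistHom Fq C n).mapMatrix h0
  rw [map_mul, map_one] at h1
  exact h1

/-- `Θ^{(1)} ⋯ Θ^{(n)}`. -/
noncomputable def psi (n : ℕ) : Matrix (Fin (k + 1)) (Fin (k + 1)) (LaurentSeries C) :=
  ((List.range n).map fun m => thetaTwist Fq F C s Q (m + 1)).prod

theorem psi_zero : psi Fq F C s Q 0 = 1 := by simp [psi]

theorem psi_succ (n : ℕ) :
    psi Fq F C s Q (n + 1) = psi Fq F C s Q n * thetaTwist Fq F C s Q (n + 1) := by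
  simp [psi, List.range_succ]

theorem PhiPrime_self (i : Fin (k + 1)) :
    PhiPrime Fq F s Q i i = tSubTheta Fq F ^ dSum s i := by
  simp [PhiPrime]

/-- The transpose of `Φ'` has a single nonzero entry in its first column and two in each later one.
Comparing columns in `Θ Φ'^tr = 1` gives a recursion across the columns of `Θ`, which replaces an
explicit inverse. -/
theorem thetaTwist_zero_column (n : ℕ) (i : Fin (k + 1)) :
    thetaTwist Fq F C s Q n i 0 * polyTwist Fq F C n (tSubTheta Fq F) ^ dSum s 0 =
      if i = 0 then 1 else 0 := by
  have h := congrFun (congrFun (thetaTwist_mul Fq F C s Q n) i) 0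
  rw [Matrix.mul_apply, Finset.sum_eq_single 0, Matrix.one_apply] at h
  · rw [← h, Matrix.transpose_apply, Matrix.map_apply, PhiPrime_self, map_pow]
  · intro j _ hj
    rw [Matrix.transpose_apply, Matrix.map_apply, PhiPrime, Matrix.of_apply, if_neg (Ne.symm hj),
      dif_neg (by simp), map_zero, mul_zero]
  · simp

theorem thetaTwist_succ_column (n : ℕ) (i : Fin (k + 1)) (j : Fin k) :
    thetaTwist Fq F C s Q (n + 1) i j.succ *
        polyTwist Fq F C (n + 1) (tSubTheta Fq F) ^ dSum s j.succ =
      (if i = j.succ then 1 else 0) - thetaTwist Fq F C s Q (n + 1) i j.castSucc *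
        polyTwist Fq F C (n + 1) (tSubTheta Fq F) ^ dSum s j.castSucc *
          polyTwist Fq F C n (Q j) := by
  have h := congrFun (congrFun (thetaTwist_mul Fq F C s Q (n + 1)) i) j.succ
  have hne : j.succ ≠ j.castSucc := (Fin.castSucc_lt_succ (i := j)).ne'
  rw [Matrix.mul_apply, Finset.sum_eq_add j.succ j.castSucc hne, Matrix.one_apply] at h
  · rw [← h, Matrix.transpose_apply, Matrix.map_apply, PhiPrime_self, map_pow,
      Matrix.transpose_apply, Matrix.map_apply, PhiPrime, Matrix.of_apply, if_neg hne,
      dif_pos (by simp), map_mul, map_pow]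
    have := polyTwist_succ_rootTwist Fq F C n (Q j)
    simp only [Fin.val_castSucc, Fin.eta]
    rw [this]
    ring
  · intro l _ hl
    rw [Matrix.transpose_apply, Matrix.map_apply, PhiPrime, Matrix.of_apply, if_neg (Ne.symm hl.1),
      dif_neg, map_zero, mul_zero]
    intro h
    apply hl.2
    ext
    simpa using h
  · simp
  · simp

end Psi

/-! ### Growth of `Θ^{(1)} ⋯ Θ^{(n)}` -/

section Growth

variable (Fq : Type*) [Field Fq] [Fintype Fq] {F : Type*} [Field F] [Algebra (RatFunc Fq) F]
  (C : Type*) [NormedField C] [Algebra (RatFunc Fq) C] [Algebra F C]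
  {k : ℕ} (s : Fin (k + 1) → ℕ+) (Q : Fin k → F[X])

/-- The sum of the degrees of the `Q_m` with `m < j`. -/
def degSum (j : Fin (k + 1)) : ℕ := ∑ m : Fin k with m.castSucc < j, (Q m).natDegree

theorem degSum_succ (j : Fin k) :
    degSum Q j.succ = degSum Q j.castSucc + (Q j).natDegree := by
  unfold degSum
  rw [show (Finset.univ.filter fun m : Fin k => m.castSucc < j.succ) =
    insert j (Finset.univ.filter fun m : Fin k => m.castSucc < j.castSucc) by
      ext m
      simp only [Finset.mem_filter, Finset.mem_univ, true_and, Finset.mem_insert, Fin.lt_def,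
        Fin.ext_iff, Fin.val_castSucc, Fin.val_succ]
      omega]
  rw [Finset.sum_insert (by simp), add_comm]

theorem dSum_castSucc (j : Fin k) :
    dSum s j.castSucc = s j.castSucc + dSum s j.succ := by
  unfold dSum
  rw [show Finset.Ici j.castSucc = insert j.castSucc (Finset.Ici j.succ) by
      ext m; simp [Fin.le_def, Fin.ext_iff]; omega]
  rw [Finset.sum_insert (by simp)]

theorem one_lt_card_real : (1 : ℝ) < Fintype.card Fq := by
  exact_mod_cast Fintype.one_lt_card (α := Fq)

/-- The coefficients of `Q_j` are bounded by `q ^ (s_j q / (q - 1))` for all `j`. -/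
def CoeffBounded : Prop := ∀ j m, ‖algebraMap F C ((Q j).coeff m)‖ ≤ (Fintype.card Fq : ℝ) ^
  (((s j.castSucc : ℕ) : ℝ) * (Fintype.card Fq : ℝ) / ((Fintype.card Fq : ℝ) - 1))

/-- The weights which bound the entries of `Θ^{(1)} ⋯ Θ^{(n)}`. -/
noncomputable def weight (n : ℕ) (j : Fin (k + 1)) : ℝ :=
  (Fintype.card Fq : ℝ) ^ ((Fintype.card Fq : ℝ) * degSum Q j -
    dSum s j * (Fintype.card Fq : ℝ) ^ (n + 1) / ((Fintype.card Fq : ℝ) - 1))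

theorem weight_pos (n : ℕ) (j : Fin (k + 1)) : 0 < weight Fq s Q n j :=
  Real.rpow_pos_of_pos (zero_lt_one.trans (one_lt_card_real Fq)) _

/-- The quotient of neighbouring weights is exactly the Gauss bound for `Q_j^{(n)}` at radius `q ^
q`: the difference `d_j - d_{j+1} = s_j` accounts for the coefficients, and `degSum` for the power
of the radius. -/
theorem weight_index_succ (n : ℕ) (j : Fin k) : weight Fq s Q n j.succ =
    weight Fq s Q n j.castSucc * (((Fintype.card Fq : ℝ) ^
      (((s j.castSucc : ℕ) : ℝ) * (Fintype.card Fq : ℝ) / ((Fintype.card Fq : ℝ) - 1))) ^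
        (Fintype.card Fq ^ n) *
      ((Fintype.card Fq : ℝ) ^ Fintype.card Fq) ^ (Q j).natDegree) := by
  have hq := one_lt_card_real Fq
  have hq0 := zero_lt_one.trans hq
  have hq1 : (Fintype.card Fq : ℝ) - 1 ≠ 0 := (sub_pos.2 hq).ne'
  unfold weight
  rw [← pow_mul, ← Real.rpow_mul_natCast hq0.le, ← Real.rpow_natCast (Fintype.card Fq : ℝ)
    (Fintype.card Fq * (Q j).natDegree), ← Real.rpow_add hq0, ← Real.rpow_add hq0, degSum_succ,
    dSum_castSucc]
  congr 1
  push_cast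
  field_simp
  ring

/-- As `q^(n+2) - q^(n+1) = (q - 1) q^(n+1)`, the new factor is the bound for the inverse of `(t -
θ^(q^(n+1)))^{d_j}`. -/
theorem weight_succ (n : ℕ) (j : Fin (k + 1)) : weight Fq s Q (n + 1) j =
    weight Fq s Q n j *
      (((Fintype.card Fq : ℝ) ^ (Fintype.card Fq ^ (n + 1)))⁻¹) ^ dSum s j := by
  have hq := one_lt_card_real Fq
  have hq0 := zero_lt_one.trans hq
  have hq1 : (Fintype.card Fq : ℝ) - 1 ≠ 0 := (sub_pos.2 hq).ne'
  unfold weight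
  rw [inv_pow, ← pow_mul, ← Real.rpow_natCast (Fintype.card Fq : ℝ)
    (Fintype.card Fq ^ (n + 1) * dSum s j), ← Real.rpow_neg hq0.le, ← Real.rpow_add hq0]
  congr 1
  push_cast
  field_simp
  ring

variable [IsAlgClosed F] [IsUltrametricDist C] [IsScalarTower (RatFunc Fq) F C]

theorem gaussBound_thetaTwist (hθ : ‖theta Fq C‖ = Fintype.card Fq)
    (hQ : CoeffBounded Fq C s Q)
    (n : ℕ) (i j : Fin (k + 1)) :
    GaussBound ((Fintype.card Fq : ℝ) ^ Fintype.card Fq)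
      (weight Fq s Q (n + 1) j / weight Fq s Q n i) (thetaTwist Fq F C s Q (n + 1) i j) := by
  have hq := one_lt_card_real Fq
  have hq0 := zero_lt_one.trans hq
  -- The radius `|θ^q|` is at most the norm of every pole `θ^(q^(n+1))`, and it does not depend on
  -- `n`.
  set R := (Fintype.card Fq : ℝ) ^ Fintype.card Fq with hR
  have hR1 : 1 ≤ R := one_le_pow₀ hq.le
  have hR0 : 0 < R := zero_lt_one.trans_le hR1
  set v := polyTwist Fq F C (n + 1) (tSubTheta Fq F) with hv
  have hα : ‖theta Fq C ^ Fintype.card Fq ^ (n + 1)‖ =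
      (Fintype.card Fq : ℝ) ^ Fintype.card Fq ^ (n + 1) := by rw [norm_pow, hθ]
  have hle : R ≤ ‖theta Fq C ^ Fintype.card Fq ^ (n + 1)‖ := by
    rw [hα]
    exact pow_le_pow_right₀ hq.le (Nat.le_self_pow (by omega) _)
  have hvinv : GaussBound R ((Fintype.card Fq : ℝ) ^ Fintype.card Fq ^ (n + 1))⁻¹ v⁻¹ := by
    rw [hv, polyTwist_tSubTheta, ← hα]
    exact gaussBound_inv_laurentT_sub hR0 hle
  have hv0 : v ≠ 0 := by
    rw [hv, polyTwist_apply]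
    exact (map_ne_zero_iff (laurentTwistHom Fq C (n + 1)) (RingHom.injective _)).2
      ((map_ne_zero_iff _ (toLaurent_injective F C)).2 (X_sub_C_ne_zero _))
  have hone (b : Fin (k + 1)) : GaussBound R (weight Fq s Q n b / weight Fq s Q n i)
      (if i = b then 1 else 0 : LaurentSeries C) := by
    split_ifs with h
    · rw [h, div_self (weight_pos Fq s Q n b).ne']
      exact GaussBound.one
    · exact GaussBound.zero (div_pos (weight_pos Fq s Q n b) (weight_pos Fq s Q n i)).le
  -- With the denominator cleared, the columns `u_j` satisfy `u_{j+1} = δ - u_j Q_j^{(n)}`, and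
  -- `weight_index_succ` propagates the bound. Dividing by `v ^ d_j` afterwards turns the weight of
  -- level `n` into that of level `n + 1`.
  have key : GaussBound R (weight Fq s Q n j / weight Fq s Q n i)
      (thetaTwist Fq F C s Q (n + 1) i j * v ^ dSum s j) := by
    induction j using Fin.induction with
    | zero => rw [thetaTwist_zero_column]; exact hone 0
    | succ j ih =>
      rw [thetaTwist_succ_column]
      refine (hone j.succ).sub hR0 ?_
      rw [weight_index_succ, mul_div_right_comm]
      exact ih.mul hR0 (gaussBound_polyTwist Fq F C hR1 n (Q j) (Real.rpow_nonneg hq0.le _) (hQ j))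
  have h2 := key.mul hR0 (hvinv.pow hR0 (dSum s j))
  rw [mul_assoc, inv_pow v, mul_inv_cancel₀ (pow_ne_zero _ hv0), mul_one] at h2
  rwa [weight_succ, mul_div_right_comm]

/-- In each summand of the matrix product the weight of the intermediate index cancels, so all
summands have the same bound and the strong triangle inequality loses nothing. -/
theorem gaussBound_psi (hθ : ‖theta Fq C‖ = Fintype.card Fq)
    (hQ : CoeffBounded Fq C s Q)
    (n : ℕ) (i j : Fin (k + 1)) :
    GaussBound ((Fintype.card Fq : ℝ) ^ Fintype.card Fq)
      (weight Fq s Q n j / weight Fq s Q 0 i) (psi Fq F C s Q n i j) := by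
  have hR0 : 0 < (Fintype.card Fq : ℝ) ^ Fintype.card Fq :=
    pow_pos (zero_lt_one.trans (one_lt_card_real Fq)) _
  have hnn (n j) : 0 ≤ weight Fq s Q n j / weight Fq s Q 0 i :=
    (div_pos (weight_pos Fq s Q n j) (weight_pos Fq s Q 0 i)).le
  induction n generalizing j with
  | zero =>
    rw [psi_zero, Matrix.one_apply]
    split_ifs with h
    · rw [h, div_self (weight_pos Fq s Q 0 j).ne']
      exact GaussBound.one
    · exact GaussBound.zero (hnn 0 j)
  | succ n ih =>
    rw [psi_succ, Matrix.mul_apply]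
    refine GaussBound.sum hR0 (hnn (n + 1) j) fun l _ => ?_
    refine ((ih l).mul hR0 (gaussBound_thetaTwist Fq C s Q hθ hQ n l j)).mono (le_of_eq ?_)
    have := (weight_pos Fq s Q n l).ne'
    field_simp

end Growth

/-! ### The functional equation of the logarithm series -/

section Log

variable (Fq : Type*) [Field Fq] [Fintype Fq] {F : Type*} [Field F] [Algebra (RatFunc Fq) F]
  (C : Type*) [NormedField C] [Algebra (RatFunc Fq) C] [Algebra F C] [IsAlgClosed F]
  {k : ℕ} (s : Fin (k + 1) → ℕ+) (Q : Fin k → F[X])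

/-- The coefficient `D((Θ^{(1)} ⋯ Θ^{(n)}) X^{(n)})|_{t = θ}` of the logarithm series. -/
noncomputable def logCoeff (n : ℕ) : Matrix (Idx s) (Idx s) C :=
  (logMatrix Fq F C s Q n).map (evalTheta Fq C)

/-- The vector of the hyperderivatives at `t = θ` of `Θ^{(1)} ⋯ Θ^{(n)} (a^{(n)})^tr`, for
`a ∈ M'`. -/
noncomputable def jetVec (n : ℕ) (a : Fin (k + 1) → F[X]) : Idx s → C := fun l =>
  jet Fq (dSum s l.1 - 1 - l.2)
    ((psi Fq F C s Q n).mulVec (fun i => polyTwist Fq F C n (a i)) l.1)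

/-- The columns of `X^{(n)}` are the twisted basis vectors `e_m`. This turns statements about the
series into statements about `M'`, where `σ` and `t` act. -/
theorem logMatrix_apply (n : ℕ) (l m : Idx s) : logMatrix Fq F C s Q n l m =
    LaurentSeries.hasseDeriv C (dSum s l.1 - 1 - l.2)
      ((psi Fq F C s Q n).mulVec (fun i => polyTwist Fq F C n (sigmaBasis Fq F s m i)) l.1) := by
  unfold logMatrix DOp
  rw [Matrix.of_apply, Matrix.mul_apply]
  congr 1
  refine Finset.sum_congr rfl fun i _ => ?_
  congr 1
  rw [Matrix.map_apply, XMat, Matrix.of_apply, sigmaBasis]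
  by_cases h : i = m.1
  · subst h
    simp [polyTwist_apply]
  · rw [if_neg h]
    beta_reduce
    rw [Pi.single_eq_of_ne h, map_zero]
    exact (laurentTwistHom Fq C n).map_zero

theorem logCoeff_apply (n : ℕ) (l m : Idx s) :
    logCoeff Fq C s Q n l m = jetVec Fq C s Q n (sigmaBasis Fq F s m) l := by
  rw [logCoeff, Matrix.map_apply, logMatrix_apply]
  rfl

variable [IsUltrametricDist C] [IsScalarTower (RatFunc Fq) F C]

/-- The twist of `σ a` is `Φ'^{(n+1)}` transposed applied to `a^{(n)}`, and the last factor
`Θ^{(n+1)}` cancels that matrix. -/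
theorem psi_mulVec_sigma (n : ℕ) (a : Fin (k + 1) → F[X]) :
    (psi Fq F C s Q (n + 1)).mulVec (fun i => polyTwist Fq F C (n + 1) (sigma Fq F s Q a i)) =
      (psi Fq F C s Q n).mulVec (fun i => polyTwist Fq F C n (a i)) := by
  have h : (fun i => polyTwist Fq F C (n + 1) (sigma Fq F s Q a i)) =
      ((PhiPrime Fq F s Q).map (polyTwist Fq F C (n + 1))).transpose.mulVec
        (fun i => polyTwist Fq F C n (a i)) := by
    funext i
    rw [Matrix.mulVec_transpose, sigma, RingHom.map_vecMul]
    congr 1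
    funext j
    exact polyTwist_succ_rootTwist Fq F C n (a j)
  rw [h, psi_succ, ← Matrix.mulVec_mulVec, Matrix.mulVec_mulVec _ (thetaTwist Fq F C s Q (n + 1)),
    thetaTwist_mul, Matrix.one_mulVec]

theorem jetVec_succ_sigma (n : ℕ) (a : Fin (k + 1) → F[X]) :
    jetVec Fq C s Q (n + 1) (sigma Fq F s Q a) = jetVec Fq C s Q n a := by
  funext l
  rw [jetVec, psi_mulVec_sigma, jetVec]

theorem one_lt_radius : 1 < (Fintype.card Fq : ℝ) ^ Fintype.card Fq :=
  one_lt_pow₀ (one_lt_card_real Fq) Fintype.card_ne_zero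

theorem norm_theta_lt_radius (hθ : ‖theta Fq C‖ = Fintype.card Fq) :
    ‖theta Fq C‖ < (Fintype.card Fq : ℝ) ^ Fintype.card Fq := by
  rw [hθ]
  exact lt_self_pow₀ (one_lt_card_real Fq) Fintype.one_lt_card

theorem exists_gaussBound_psi_mulVec (hθ : ‖theta Fq C‖ = Fintype.card Fq)
    (hQ : CoeffBounded Fq C s Q) (n : ℕ) (a : Fin (k + 1) → F[X]) (i : Fin (k + 1)) :
    ∃ B, GaussBound ((Fintype.card Fq : ℝ) ^ Fintype.card Fq) B
      ((psi Fq F C s Q n).mulVec (fun i => polyTwist Fq F C n (a i)) i) := by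
  have hR := one_lt_radius Fq
  have hR0 := zero_lt_one.trans hR
  choose b hb using fun j => exists_gaussBound_polyTwist Fq F C hR.le n (a j)
  have h1 (j) := (gaussBound_psi Fq C s Q hθ hQ n i j).mul hR0 (hb j)
  rw [Matrix.mulVec, dotProduct]
  refine ⟨∑ j, weight Fq s Q n j / weight Fq s Q 0 i * b j,
    GaussBound.sum hR0 (Finset.sum_nonneg fun j _ => (h1 j).bound_nonneg)
    fun j _ => (h1 j).mono ?_⟩
  exact Finset.single_le_sum (f := fun j => weight Fq s Q n j / weight Fq s Q 0 i * b j)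
    (fun j _ => (h1 j).bound_nonneg) (Finset.mem_univ j)

variable [CompleteSpace C]

theorem inTate_logMatrix (hθ : ‖theta Fq C‖ = Fintype.card Fq) (hQ : CoeffBounded Fq C s Q)
    (n : ℕ) (l m : Idx s) : InTate Fq C (logMatrix Fq F C s Q n l m) := by
  rw [logMatrix_apply]
  obtain ⟨B, hB⟩ := exists_gaussBound_psi_mulVec Fq C s Q hθ hQ n (sigmaBasis Fq F s m) l.1
  exact (hB.hasseDeriv (one_lt_radius Fq).le _).inTate Fq (norm_theta_lt_radius Fq C hθ)

theorem jetVec_add (hθ : ‖theta Fq C‖ = Fintype.card Fq) (hQ : CoeffBounded Fq C s Q)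
    (n : ℕ) (a b : Fin (k + 1) → F[X]) :
    jetVec Fq C s Q n (a + b) = jetVec Fq C s Q n a + jetVec Fq C s Q n b := by
  funext l
  obtain ⟨B, hB⟩ := exists_gaussBound_psi_mulVec Fq C s Q hθ hQ n a l.1
  obtain ⟨B', hB'⟩ := exists_gaussBound_psi_mulVec Fq C s Q hθ hQ n b l.1
  rw [Pi.add_apply, jetVec, jetVec, jetVec,
    ← jet_add Fq (one_lt_radius Fq).le (norm_theta_lt_radius Fq C hθ) hB hB', ← Pi.add_apply,
    ← Matrix.mulVec_add]
  congr 3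
  funext i
  simp

theorem jetVec_smul (n : ℕ) (x : F) (a : Fin (k + 1) → F[X]) (l : Idx s) :
    jetVec Fq C s Q n (x • a) l =
      algebraMap F C x ^ (Fintype.card Fq ^ n) * jetVec Fq C s Q n a l := by
  rw [jetVec, jetVec, ← jet_single_zero_mul, ← smul_eq_mul, ← Pi.smul_apply, ← Matrix.mulVec_smul]
  congr 2
  funext i
  rw [Pi.smul_apply, Pi.smul_apply, Polynomial.smul_eq_C_mul, map_mul, polyTwist_C, smul_eq_mul]

/-- At level `0` there is no `Θ` to cancel; instead the `i`-th entry of `σ a` vanishes to order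
`d_i` at `θ`, and only orders up to `d_i - 1` are read off. -/
theorem jetVec_zero_sigma (hθ : ‖theta Fq C‖ = Fintype.card Fq) (a : Fin (k + 1) → F[X]) :
    jetVec Fq C s Q 0 (sigma Fq F s Q a) = 0 := by
  funext l
  obtain ⟨b, hb⟩ := dvd_sigma Fq F s Q a l.1
  obtain ⟨B, hB⟩ := exists_gaussBound_polyTwist Fq F C (one_lt_radius Fq).le 0 b
  rw [jetVec, psi_zero, Matrix.one_mulVec, hb, map_mul, map_pow, polyTwist_tSubTheta, pow_zero,
    pow_one, Pi.zero_apply]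
  exact jet_sub_theta_pow_mul Fq (one_lt_radius Fq).le (norm_theta_lt_radius Fq C hθ) hB
    (by have := l.2.2; omega)

theorem jetVec_smul_iterate_sigma (hθ : ‖theta Fq C‖ = Fintype.card Fq) (n i : ℕ) (x : F)
    (a : Fin (k + 1) → F[X]) (l : Idx s) :
    jetVec Fq C s Q n (x • (sigma Fq F s Q)^[i] a) l =
      if i ≤ n then algebraMap F C x ^ (Fintype.card Fq ^ n) * jetVec Fq C s Q (n - i) a l
      else 0 := by
  rw [jetVec_smul]
  have h (n i : ℕ) : jetVec Fq C s Q n ((sigma Fq F s Q)^[i] a) =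
      if i ≤ n then jetVec Fq C s Q (n - i) a else 0 := by
    induction i generalizing n with
    | zero => simp
    | succ i ih =>
      rw [Function.iterate_succ_apply']
      cases n with
      | zero => rw [jetVec_zero_sigma Fq C s Q hθ]; simp
      | succ n => rw [jetVec_succ_sigma, ih]; simp
  rw [h]
  split_ifs <;> simp

/-- `∂ρ(t)` is `θ` plus a shift inside each block. As coordinates are ordered by decreasing order of
derivative, this is how multiplication by `t` acts on Taylor coefficients at `θ`. -/
theorem rhoT_zero_mulVec (v : Idx s → C) (l : Idx s) :
    (((tModule Fq F s Q).rhoT 0).map (algebraMap F C)).mulVec v l = theta Fq C * v l +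
      if h : (l.2 : ℕ) + 1 < dSum s l.1 then v ⟨l.1, ⟨l.2 + 1, h⟩⟩ else 0 := by
  have h0 (m : Idx s) : ((tModule Fq F s Q).rhoT 0).map (algebraMap F C) l m =
      (if l = m then theta Fq C else 0) +
        if l.1 = m.1 ∧ (l.2 : ℕ) + 1 = m.2 then 1 else 0 := by
    have h1 : (tModule Fq F s Q).rhoT 0 l m = (if l = m then theta Fq F else 0) +
        if l.1 = m.1 ∧ (l.2 : ℕ) + 1 = m.2 then 1 else 0 := by
      rw [← rhoTCoeff_zero Fq F s Q l m, Matrix.sub_apply, Matrix.smul_apply, Matrix.one_apply]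
      simp only [smul_eq_mul, mul_ite, mul_one, mul_zero, add_sub_cancel]
      rfl
    rw [Matrix.map_apply, h1, map_add]
    congr 1
    · split_ifs
      · exact algebraMap_theta Fq F C
      · exact map_zero _
    · split_ifs <;> simp
  simp only [Matrix.mulVec, dotProduct, h0, add_mul, Finset.sum_add_distrib, ite_mul, zero_mul,
    one_mul, Finset.sum_ite_eq, Finset.mem_univ, if_true]
  congr 1
  split_ifs with h
  · rw [Finset.sum_eq_single (⟨l.1, ⟨l.2 + 1, h⟩⟩ : Idx s)]
    · simp
    · rintro ⟨m1, m2⟩ _ hm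
      refine if_neg ?_
      rintro ⟨rfl, h2⟩
      apply hm
      congr 1
      ext
      exact h2.symm
    · simp
  · refine Finset.sum_eq_zero fun m _ => if_neg ?_
    rintro ⟨h1, h2⟩
    have := m.2.2
    have h3 := congrArg (dSum s) h1
    omega

theorem jetVec_X_smul (hθ : ‖theta Fq C‖ = Fintype.card Fq) (hQ : CoeffBounded Fq C s Q)
    (n : ℕ) (a : Fin (k + 1) → F[X]) :
    jetVec Fq C s Q n ((X : F[X]) • a) =
      (((tModule Fq F s Q).rhoT 0).map (algebraMap F C)).mulVec (jetVec Fq C s Q n a) := by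
  funext l
  obtain ⟨B, hB⟩ := exists_gaussBound_psi_mulVec Fq C s Q hθ hQ n a l.1
  have hR1 := (one_lt_radius Fq).le
  have hR := norm_theta_lt_radius Fq C hθ
  have h1 : (psi Fq F C s Q n).mulVec (fun i => polyTwist Fq F C n (((X : F[X]) • a) i)) l.1 =
      laurentT C * (psi Fq F C s Q n).mulVec (fun i => polyTwist Fq F C n (a i)) l.1 := by
    rw [← smul_eq_mul (a := laurentT C), ← Pi.smul_apply, ← Matrix.mulVec_smul]
    congr 1
    funext i
    rw [Pi.smul_apply, Pi.smul_apply, smul_eq_mul, smul_eq_mul, map_mul, polyTwist_X]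
  rw [rhoT_zero_mulVec, jetVec, h1]
  split_ifs with h
  · rw [show dSum s l.1 - 1 - (l.2 : ℕ) = (dSum s l.1 - 1 - ((l.2 : ℕ) + 1)) + 1 by omega,
      jet_succ_laurentT_mul Fq hR1 hR hB]
    unfold jetVec
    dsimp only
    rw [show dSum s l.1 - 1 - (l.2 : ℕ) = (dSum s l.1 - 1 - ((l.2 : ℕ) + 1)) + 1 by omega]
  · rw [show dSum s l.1 - 1 - (l.2 : ℕ) = 0 by omega, jet_zero_laurentT_mul Fq hR1 hR hB, add_zero]
    unfold jetVec
    rw [show dSum s l.1 - 1 - (l.2 : ℕ) = 0 by omega]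

/-- The identity `∂ρ(t) ∘ Log = Log ∘ ρ(t)` of twisted power series. -/
theorem rhoT_zero_mul_logCoeff (hθ : ‖theta Fq C‖ = Fintype.card Fq)
    (hQ : CoeffBounded Fq C s Q) (n : ℕ) :
    ((tModule Fq F s Q).rhoT 0).map (algebraMap F C) * logCoeff Fq C s Q n =
      ∑ i ∈ Finset.range (n + 1), logCoeff Fq C s Q (n - i) *
        (((tModule Fq F s Q).rhoT i).map (algebraMap F C)).map (frob Fq C (n - i)) := by
  ext l m
  -- Both sides compute the Taylor coefficients attached to `t e_m`: the left through the action of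
  -- `t`, the right by expanding `t e_m` in the `σ`-basis.
  have h1 : (((tModule Fq F s Q).rhoT 0).map (algebraMap F C) * logCoeff Fq C s Q n) l m =
      jetVec Fq C s Q n ((X : F[X]) • sigmaBasis Fq F s m) l := by
    rw [jetVec_X_smul Fq C s Q hθ hQ, Matrix.mul_apply, Matrix.mulVec, dotProduct]
    exact Finset.sum_congr rfl fun j _ => by rw [logCoeff_apply]
  let J : (Fin (k + 1) → F[X]) →+ C := AddMonoidHom.mk' (fun a => jetVec Fq C s Q n a l)
    fun a b => by rw [jetVec_add Fq C s Q hθ hQ]; rfl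
  have hJ (a) : jetVec Fq C s Q n a l = J a := rfl
  rw [h1, ← sigmaComb_iota Fq F s Q ((X : F[X]) • sigmaBasis Fq F s m), hJ, sigmaComb, map_sum,
    Matrix.sum_apply]
  simp only [Matrix.mul_apply]
  rw [Finset.sum_comm]
  refine Finset.sum_congr rfl fun j _ => ?_
  rw [Finsupp.sum, map_sum]
  simp only [← hJ, jetVec_smul_iterate_sigma Fq C s Q hθ]
  rw [← Finset.sum_filter]
  set c := iota Fq F s Q ((X : F[X]) • sigmaBasis Fq F s m) j with hc
  have hq (n : ℕ) : Fintype.card Fq ^ n ≠ 0 := pow_ne_zero _ Fintype.card_ne_zero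
  refine (Finset.sum_subset (s₂ := Finset.range (n + 1)) (fun i hi => ?_) fun i hi hi' => ?_).trans
    (Finset.sum_congr rfl fun i hi => ?_)
  · have := (Finset.mem_filter.1 hi).2
    exact Finset.mem_range.2 (by omega)
  · have h2 : c i = 0 := by
      by_contra h
      exact hi' (Finset.mem_filter.2 ⟨Finsupp.mem_support_iff.2 h,
        Nat.lt_succ_iff.1 (Finset.mem_range.1 hi)⟩)
    rw [h2, map_zero, zero_pow (hq n), zero_mul]
  · have hin : i ≤ n := Nat.lt_succ_iff.1 (Finset.mem_range.1 hi)
    rw [logCoeff_apply, mul_comm]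
    congr 1
    -- The entries of `ρ(t)` at `τ ^ i` are `q ^ i`-th powers of `σ`-coordinates, and the twist by
    -- `n - i` completes them to `q ^ n`-th powers.
    rw [Matrix.map_apply, Matrix.map_apply,
      show (tModule Fq F s Q).rhoT i j m = c i ^ (Fintype.card Fq ^ i) from rfl, frob_apply,
      map_pow, ← pow_mul, ← pow_add]
    congr 2
    omega

theorem logCoeff_zero (hθ : ‖theta Fq C‖ = Fintype.card Fq) : logCoeff Fq C s Q 0 = 1 := by
  ext l m
  rw [logCoeff_apply, jetVec, psi_zero, Matrix.one_mulVec, sigmaBasis, Matrix.one_apply]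
  by_cases h : l.1 = m.1
  · obtain ⟨l1, l2⟩ := l
    obtain ⟨m1, m2⟩ := m
    dsimp only at h
    subst h
    rw [Pi.single_eq_same, map_pow, polyTwist_tSubTheta, pow_zero, pow_one,
      jet_sub_theta_pow Fq (one_lt_radius Fq).le (norm_theta_lt_radius Fq C hθ)]
    refine if_congr ?_ rfl rfl
    have := l2.2
    have := m2.2
    simp only [Sigma.mk.injEq, heq_eq_eq, true_and, Fin.ext_iff]
    omega
  · rw [Pi.single_eq_of_ne h, map_zero, if_neg (fun hlm => h (by rw [hlm]))]
    unfold jet evalTheta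
    simp

/-- A positive index is needed: only then is the radius `q ^ q` at most `|θ^(q^(n+1))|`, so that the
twisted `t - θ` has Gauss norm at most the latter. -/
theorem norm_logCoeff_succ_le (hθ : ‖theta Fq C‖ = Fintype.card Fq) (hQ : CoeffBounded Fq C s Q)
    (n : ℕ) (l m : Idx s) : ‖logCoeff Fq C s Q (n + 1) l m‖ ≤
      weight Fq s Q (n + 1) m.1 / weight Fq s Q 0 l.1 *
        ((Fintype.card Fq : ℝ) ^ (Fintype.card Fq ^ (n + 1))) ^ (dSum s m.1 - 1 - m.2) := by
  have hR := one_lt_radius Fq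
  have hR0 := zero_lt_one.trans hR
  have hle : (Fintype.card Fq : ℝ) ^ Fintype.card Fq ≤
      (Fintype.card Fq : ℝ) ^ (Fintype.card Fq ^ (n + 1)) :=
    pow_le_pow_right₀ (one_lt_card_real Fq).le (Nat.le_self_pow (by omega) _)
  have hv : GaussBound ((Fintype.card Fq : ℝ) ^ Fintype.card Fq)
      ((Fintype.card Fq : ℝ) ^ (Fintype.card Fq ^ (n + 1)))
      (polyTwist Fq F C (n + 1) (tSubTheta Fq F)) := by
    rw [polyTwist_tSubTheta]
    refine ((gaussBound_laurentT hR0).mono hle).sub hR0 ((GaussBound.single_zero _).mono ?_)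
    rw [norm_pow, hθ]
  rw [logCoeff_apply]
  refine norm_jet_le Fq hR.le (norm_theta_lt_radius Fq C hθ) ?_ _
  rw [Matrix.mulVec, dotProduct, Finset.sum_eq_single m.1]
  · rw [sigmaBasis, Pi.single_eq_same, map_pow]
    exact (gaussBound_psi Fq C s Q hθ hQ (n + 1) l.1 m.1).mul hR0 (hv.pow hR0 _)
  · intro j _ hj
    rw [sigmaBasis, Pi.single_eq_of_ne hj, map_zero, mul_zero]
  · simp

theorem tendsto_pow_card_pow {x : ℝ} (hx0 : 0 ≤ x) (hx : x < 1) :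
    Filter.Tendsto (fun n => x ^ (Fintype.card Fq ^ n)) Filter.atTop (nhds 0) :=
  (tendsto_pow_atTop_nhds_zero_of_lt_one hx0 hx).comp
    (tendsto_pow_atTop_atTop_of_one_lt Fintype.one_lt_card)

theorem tendsto_norm_logCoeff_mul (hθ : ‖theta Fq C‖ = Fintype.card Fq)
    (hQ : CoeffBounded Fq C s Q) (l m : Idx s) {x : ℝ} (hx0 : 0 ≤ x)
    (hx : x < (Fintype.card Fq : ℝ) ^
      (((m.2 : ℕ) : ℝ) + 1 + (dSum s m.1 : ℝ) / ((Fintype.card Fq : ℝ) - 1))) :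
    Filter.Tendsto (fun n => ‖logCoeff Fq C s Q n l m‖ * x ^ (Fintype.card Fq ^ n))
      Filter.atTop (nhds 0) := by
  have hq := one_lt_card_real Fq
  have hq0 := zero_lt_one.trans hq
  have hq1 : (Fintype.card Fq : ℝ) - 1 ≠ 0 := (sub_pos.2 hq).ne'
  set y := (Fintype.card Fq : ℝ) ^
      (((m.2 : ℕ) : ℝ) + 1 + (dSum s m.1 : ℝ) / ((Fintype.card Fq : ℝ) - 1)) with hy
  have hy0 : 0 < y := Real.rpow_pos_of_pos hq0 _
  rw [← Filter.tendsto_add_atTop_iff_nat 1]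
  set K := (Fintype.card Fq : ℝ) ^ ((Fintype.card Fq : ℝ) * degSum Q m.1) / weight Fq s Q 0 l.1
    with hK
  have hlim : Filter.Tendsto (fun n => K * (x / y) ^ (Fintype.card Fq ^ (n + 1)))
      Filter.atTop (nhds 0) := by
    rw [Filter.tendsto_add_atTop_iff_nat (f := fun n => K * (x / y) ^ (Fintype.card Fq ^ n)) 1]
    simpa using (tendsto_pow_card_pow Fq (div_nonneg hx0 hy0.le) ((div_lt_one hy0).2 hx)).const_mul K
  refine squeeze_zero (fun n => by positivity) (fun n => ?_) hlim
  refine (mul_le_mul_of_nonneg_right (norm_logCoeff_succ_le Fq C s Q hθ hQ n l m)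
    (by positivity)).trans (le_of_eq ?_)
  -- With `d` and `j` the size and zero-based position in the block, `-d q/(q-1) + (d - 1 - j) + (j
  -- + 1 + d/(q-1)) = 0`. Everything depending on `n` cancels, so `y` is the radius at which the
  -- bound is constant.
  have hw : weight Fq s Q (n + 1) m.1 *
      ((Fintype.card Fq : ℝ) ^ (Fintype.card Fq ^ (n + 1))) ^ (dSum s m.1 - 1 - m.2) *
        y ^ (Fintype.card Fq ^ (n + 1)) =
      (Fintype.card Fq : ℝ) ^ ((Fintype.card Fq : ℝ) * degSum Q m.1) := by
    have hm : ((dSum s m.1 - 1 - (m.2 : ℕ) : ℕ) : ℝ) = dSum s m.1 - 1 - (m.2 : ℕ) := by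
      have := m.2.2
      rw [Nat.cast_sub (by omega), Nat.cast_sub (by omega), Nat.cast_one]
    rw [hy, weight, ← pow_mul, ← Real.rpow_mul_natCast hq0.le, ← Real.rpow_natCast _
      (Fintype.card Fq ^ (n + 1) * _), ← Real.rpow_add hq0, ← Real.rpow_add hq0]
    congr 1
    push_cast
    rw [hm]
    field_simp
    ring
  rw [div_pow, ← mul_div_assoc, eq_div_iff (pow_pos hy0 _).ne', hK, ← hw]
  have := (weight_pos Fq s Q 0 l.1).ne'
  field_simp

end Log

/-! ### Twisted power series with matrix coefficients -/

section SkewMul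

variable (Fq : Type*) [Field Fq] [Fintype Fq] {C : Type*} [Field C] [Algebra (RatFunc Fq) C]
  {n : Type*} [Fintype n] [DecidableEq n]

/-- The product of `∑ᵢ aᵢ τ ^ i` and `∑ⱼ bⱼ τ ^ j` in `Mat_n(C)[[τ]]`. -/
def skewMul (a b : ℕ → Matrix n n C) (m : ℕ) : Matrix n n C :=
  ∑ p ∈ Finset.HasAntidiagonal.antidiagonal m, a p.1 * (b p.2).map (frob Fq C p.1)

theorem map_frob_map_frob (M : Matrix n n C) (i j : ℕ) :
    (M.map (frob Fq C j)).map (frob Fq C i) = M.map (frob Fq C (i + j)) := by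
  ext l m
  simp only [Matrix.map_apply, frob_apply]
  rw [← pow_mul, ← pow_add, add_comm]

theorem map_frob_mul (M M' : Matrix n n C) (i : ℕ) :
    (M * M').map (frob Fq C i) = M.map (frob Fq C i) * M'.map (frob Fq C i) :=
  Matrix.map_mul

theorem map_frob_sum {ι : Type*} (S : Finset ι) (M : ι → Matrix n n C) (i : ℕ) :
    (∑ j ∈ S, M j).map (frob Fq C i) = ∑ j ∈ S, (M j).map (frob Fq C i) :=
  map_sum (frob Fq C i).mapMatrix M S

theorem map_frob_zero (M : Matrix n n C) : M.map (frob Fq C 0) = M := by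
  ext l m; simp

theorem skewMul_assoc (a b c : ℕ → Matrix n n C) :
    skewMul Fq (skewMul Fq a b) c = skewMul Fq a (skewMul Fq b c) := by
  funext m
  simp only [skewMul, map_frob_sum, map_frob_mul, map_frob_map_frob, Finset.sum_mul,
    Finset.mul_sum, Finset.sum_sigma']
  refine Finset.sum_nbij' (fun x => ⟨(x.2.1, x.2.2 + x.1.2), (x.2.2, x.1.2)⟩)
    (fun x => ⟨(x.1.1 + x.2.1, x.2.2), (x.1.1, x.2.1)⟩) ?_ ?_ ?_ ?_ ?_
  · rintro ⟨⟨i, j⟩, ⟨i', j'⟩⟩ h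
    simp only [Finset.mem_sigma, Finset.HasAntidiagonal.mem_antidiagonal, and_true] at h ⊢
    omega
  · rintro ⟨⟨i, j⟩, ⟨i', j'⟩⟩ h
    simp only [Finset.mem_sigma, Finset.HasAntidiagonal.mem_antidiagonal, and_true] at h ⊢
    omega
  · rintro ⟨⟨i, j⟩, ⟨i', j'⟩⟩ h
    simp only [Finset.mem_sigma, Finset.HasAntidiagonal.mem_antidiagonal] at h ⊢
    obtain ⟨h1, rfl⟩ := h
    rfl
  · rintro ⟨⟨i, j⟩, ⟨i', j'⟩⟩ h
    simp only [Finset.mem_sigma, Finset.HasAntidiagonal.mem_antidiagonal] at h ⊢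
    obtain ⟨h1, rfl⟩ := h
    rfl
  · rintro ⟨⟨i, j⟩, ⟨i', j'⟩⟩ h
    simp only [Finset.mem_sigma, Finset.HasAntidiagonal.mem_antidiagonal] at h ⊢
    obtain ⟨h1, rfl⟩ := h
    rw [mul_assoc]

theorem skewMul_single_zero (a : ℕ → Matrix n n C) (A : Matrix n n C) (m : ℕ) :
    skewMul Fq a (Pi.single 0 A) m = a m * A.map (frob Fq C m) := by
  rw [skewMul, Finset.sum_eq_single (m, 0)]
  · simp
  · rintro ⟨i, j⟩ h hne
    have hj : j ≠ 0 := by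
      rintro rfl
      exact hne (by simpa using h)
    rw [Pi.single_eq_of_ne hj, Matrix.map_zero _ (map_zero _), mul_zero]
  · simp

theorem single_zero_skewMul (A : Matrix n n C) (b : ℕ → Matrix n n C) (m : ℕ) :
    skewMul Fq (Pi.single 0 A) b m = A * b m := by
  rw [skewMul, Finset.sum_eq_single (0, m)]
  · rw [map_frob_zero, Pi.single_eq_same]
  · rintro ⟨i, j⟩ h hne
    have hi : i ≠ 0 := by
      rintro rfl
      exact hne (by simpa using h)
    rw [Pi.single_eq_of_ne hi, zero_mul]
  · simp

end SkewMul

/-! ### The exponential series is entire -/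

section Entire

variable {Fq : Type*} [Field Fq] [Fintype Fq] {F : Type*} [Field F] [Algebra (RatFunc Fq) F]
  (C : Type*) [NormedField C] [Algebra (RatFunc Fq) C] [Algebra F C]
  {n : Type*} [Fintype n] [DecidableEq n] (G : TModule Fq F n)

namespace TModule

/-- The coefficients of `ρ(t)`, viewed over `C ⊇ F`. -/
def rhoC (i : ℕ) : Matrix n n C := (G.rhoT i).map (algebraMap F C)

/-- The coefficients of the exponential series, viewed over `C ⊇ F`. -/
noncomputable def expC (i : ℕ) : Matrix n n C := (G.expCoeff i).map (algebraMap F C)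

theorem map_frob_map_algebraMap (M : Matrix n n F) (i : ℕ) :
    (M.map (frob Fq F i)).map (algebraMap F C) =
      (M.map (algebraMap F C)).map (frob Fq C i) := by
  ext l m
  simp

theorem expC_zero : G.expC C 0 = 1 := by
  rw [expC, G.isExpCoeff_expCoeff.1]
  exact Matrix.map_one _ (map_zero _) (map_one _)

theorem skewMul_expC : skewMul Fq (G.expC C) (Pi.single 0 (G.rhoC C 0)) =
    skewMul Fq (G.rhoC C) (G.expC C) := by
  funext m
  rw [skewMul_single_zero, skewMul, Finset.Nat.sum_antidiagonal_eq_sum_range_succ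
    (fun i j => G.rhoC C i * (G.expC C j).map (frob Fq C i))]
  have h := congrArg (algebraMap F C).mapMatrix (G.isExpCoeff_expCoeff.2 m)
  simp only [map_sum, map_mul, RingHom.mapMatrix_apply, map_frob_map_algebraMap] at h
  exact h

theorem expC_sylvester (m : ℕ) :
    G.expC C m * (G.rhoC C 0).map (frob Fq C m) - G.rhoC C 0 * G.expC C m =
      ∑ i : Fin m, G.rhoC C (m - i) * (G.expC C i).map (frob Fq C (m - i)) := by
  have h := congrArg (algebraMap F C).mapMatrix
    ((G.isExpCoeff_iff_succ _ m).1 (G.isExpCoeff_expCoeff.2 m))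
  simp only [map_sub, map_sum, map_mul, RingHom.mapMatrix_apply, map_frob_map_algebraMap] at h
  exact h

/-- The nilpotent part of `∂ρ(t)` has entries of absolute value at most `1`. -/
def NilpotentPartIntegral : Prop :=
  ∀ l m, ‖(G.rhoC C 0 - theta Fq C • (1 : Matrix n n C)) l m‖ ≤ 1

variable {C} {G} [IsUltrametricDist C]

theorem norm_sub_le_max_norm (x y : C) : ‖x - y‖ ≤ max ‖x‖ ‖y‖ := by
  rw [sub_eq_add_neg, ← norm_neg y]
  exact IsUltrametricDist.norm_add_le_max x (-y)

/-- The Sylvester operator is multiplication by `θ^(q^m) - θ`, of norm `q^(q^m) > 1`, plus a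
perturbation by nilpotent parts which does not increase the maximal entry. The scalar therefore
dominates. -/
theorem norm_mul_card_pow_le_of_sylvester (hθ : ‖theta Fq C‖ = Fintype.card Fq)
    (hN : G.NilpotentPartIntegral C) {m : ℕ} (hm : m ≠ 0) {M : Matrix n n C} {B : ℝ}
    (hM : ∀ l l', ‖(M * (G.rhoC C 0).map (frob Fq C m) - G.rhoC C 0 * M) l l'‖ ≤ B) (l l' : n) :
    ‖M l l'‖ * (Fintype.card Fq : ℝ) ^ (Fintype.card Fq ^ m) ≤ B := by
  have hq := one_lt_card_real Fq
  have hq0 := zero_lt_one.trans hq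
  set N := G.rhoC C 0 - theta Fq C • (1 : Matrix n n C) with hNdef
  have hA : G.rhoC C 0 = theta Fq C • (1 : Matrix n n C) + N := by rw [hNdef]; abel
  have hAm : (G.rhoC C 0).map (frob Fq C m) =
      theta Fq C ^ (Fintype.card Fq ^ m) • (1 : Matrix n n C) + N.map (frob Fq C m) := by
    rw [hA, Matrix.map_add _ (map_add (frob Fq C m))]
    congr 1
    ext i j
    by_cases h : i = j <;> simp [h]
  have hS : M * (G.rhoC C 0).map (frob Fq C m) - G.rhoC C 0 * M =
      (theta Fq C ^ (Fintype.card Fq ^ m) - theta Fq C) • M +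
        (M * N.map (frob Fq C m) - N * M) := by
    rw [hAm]
    conv_lhs => rw [hA]
    rw [mul_add, add_mul, Matrix.mul_smul, Matrix.smul_mul, mul_one, one_mul, sub_smul]
    abel
  have hnorm : ‖theta Fq C ^ (Fintype.card Fq ^ m) - theta Fq C‖ =
      (Fintype.card Fq : ℝ) ^ (Fintype.card Fq ^ m) := by
    have h1 : ‖theta Fq C‖ < ‖theta Fq C ^ (Fintype.card Fq ^ m)‖ := by
      rw [norm_pow, hθ]
      exact lt_self_pow₀ hq (Nat.one_lt_pow hm Fintype.one_lt_card)
    rw [sub_eq_add_neg, IsUltrametricDist.norm_add_eq_max_of_norm_ne_norm (by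
      rw [norm_neg]; exact h1.ne'), norm_neg, max_eq_left h1.le, norm_pow, hθ]
  have hQ1 : 1 < (Fintype.card Fq : ℝ) ^ (Fintype.card Fq ^ m) :=
    one_lt_pow₀ hq (pow_ne_zero _ Fintype.card_ne_zero)
  -- At an entry of maximal norm `b` the perturbation is at most `b`, so it can win the maximum only
  -- if `b = 0`.
  obtain ⟨p, -, hp⟩ := Finset.exists_max_image (Finset.univ : Finset (n × n))
    (fun p => ‖M p.1 p.2‖) ⟨(l, l'), Finset.mem_univ _⟩
  set b := ‖M p.1 p.2‖ with hb
  have hb0 : 0 ≤ b := norm_nonneg _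
  have hMb (i j) : ‖M i j‖ ≤ b := hp (i, j) (Finset.mem_univ _)
  have hE : ‖(M * N.map (frob Fq C m) - N * M) p.1 p.2‖ ≤ b := by
    rw [Matrix.sub_apply]
    refine (norm_sub_le_max_norm _ _).trans (max_le ?_ ?_)
    · rw [Matrix.mul_apply]
      refine IsUltrametricDist.norm_sum_le_of_forall_le_of_nonneg hb0 fun j _ => ?_
      rw [norm_mul, Matrix.map_apply, frob_apply, norm_pow]
      exact (mul_le_of_le_one_right (norm_nonneg _) (pow_le_one₀ (norm_nonneg _) (hN _ _))).trans
        (hMb _ _)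
    · rw [Matrix.mul_apply]
      refine IsUltrametricDist.norm_sum_le_of_forall_le_of_nonneg hb0 fun j _ => ?_
      rw [norm_mul]
      exact (mul_le_of_le_one_left (norm_nonneg _) (hN _ _)).trans (hMb _ _)
  have hmain : b * (Fintype.card Fq : ℝ) ^ (Fintype.card Fq ^ m) ≤ max B b := by
    have h1 : (theta Fq C ^ (Fintype.card Fq ^ m) - theta Fq C) * M p.1 p.2 =
        (M * (G.rhoC C 0).map (frob Fq C m) - G.rhoC C 0 * M) p.1 p.2 -
          (M * N.map (frob Fq C m) - N * M) p.1 p.2 := by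
      rw [hS, Matrix.add_apply, Matrix.smul_apply, smul_eq_mul, add_sub_cancel_right]
    rw [hb, mul_comm, ← hnorm, ← norm_mul, h1]
    exact (norm_sub_le_max_norm _ _).trans (max_le_max (hM _ _) hE)
  refine (mul_le_mul_of_nonneg_right (hMb l l') (zero_le_one.trans hQ1.le)).trans ?_
  rcases le_max_iff.1 hmain with h | h
  · exact h
  · have hb' : b = 0 := by nlinarith
    rw [hb', zero_mul]
    exact (norm_nonneg _).trans (hM l l')

/-- If the coefficients of `Log` satisfy `∂ρ(t) ∘ Log = Log ∘ ρ(t)`, then `Exp ∘ Log = 1`. -/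
theorem skewMul_expC_eq_one (hθ : ‖theta Fq C‖ = Fintype.card Fq)
    (hN : G.NilpotentPartIntegral C) {P : ℕ → Matrix n n C} (hP0 : P 0 = 1)
    (hP : skewMul Fq (Pi.single 0 (G.rhoC C 0)) P = skewMul Fq P (G.rhoC C)) :
    skewMul Fq (G.expC C) P = Pi.single 0 1 := by
  set T := skewMul Fq (G.expC C) P with hT
  -- `E P ρ(t) = E ∂ρ(t) P = ρ(t) E P`.
  have hcomm : skewMul Fq T (G.rhoC C) = skewMul Fq (G.rhoC C) T := by
    rw [hT, skewMul_assoc, ← hP, ← skewMul_assoc, skewMul_expC, skewMul_assoc]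
  have hT0 : T 0 = 1 := by
    simp [hT, skewMul, expC_zero, hP0, map_frob_zero]
  funext m
  induction m using Nat.strong_induction_on with
  | _ m ih =>
    by_cases hm : m = 0
    · subst hm; rw [hT0, Pi.single_eq_same]
    rw [Pi.single_eq_of_ne hm]
    -- By induction only `T 0 = 1` and `T m` contribute in degree `m`. The term `ρ_m` is common to
    -- both sides, leaving a homogeneous Sylvester equation for `T m`.
    have h1 : skewMul Fq T (G.rhoC C) m = T m * (G.rhoC C 0).map (frob Fq C m) + G.rhoC C m := by
      rw [skewMul, Finset.sum_eq_add (m, 0) (0, m) (fun h => hm (Prod.ext_iff.1 h).1)]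
      · rw [hT0, map_frob_zero, one_mul]
      · rintro ⟨i, j⟩ h hne
        have h' := Finset.HasAntidiagonal.mem_antidiagonal.1 h
        dsimp only at h'
        have hi : i ≠ 0 := by rintro rfl; exact hne.2 (by simp; omega)
        have hj : j ≠ 0 := by rintro rfl; exact hne.1 (by simp; omega)
        rw [ih i (by omega), Pi.single_eq_of_ne hi, zero_mul]
      · simp
      · simp
    have h2 : skewMul Fq (G.rhoC C) T m = G.rhoC C 0 * T m + G.rhoC C m := by
      rw [skewMul, Finset.sum_eq_add (0, m) (m, 0) (fun h => hm (Prod.ext_iff.1 h).2)]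
      · rw [hT0, map_frob_zero, Matrix.map_one _ (map_zero _) (map_one _), mul_one]
      · rintro ⟨i, j⟩ h hne
        have h' := Finset.HasAntidiagonal.mem_antidiagonal.1 h
        dsimp only at h'
        have hi : i ≠ 0 := by rintro rfl; exact hne.1 (by simp; omega)
        have hj : j ≠ 0 := by rintro rfl; exact hne.2 (by simp; omega)
        rw [ih j (by omega), Pi.single_eq_of_ne hj, Matrix.map_zero _ (map_zero _), mul_zero]
      · simp
      · simp
    have h3 : T m * (G.rhoC C 0).map (frob Fq C m) - G.rhoC C 0 * T m = 0 := by
      rw [sub_eq_zero]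
      have := congrFun hcomm m
      rw [h1, h2] at this
      exact add_right_cancel this
    ext l l'
    have h4 := norm_mul_card_pow_le_of_sylvester hθ hN hm (M := T m) (B := 0)
      (fun l l' => by rw [h3]; simp) l l'
    have hpos : 0 < (Fintype.card Fq : ℝ) ^ (Fintype.card Fq ^ m) :=
      pow_pos (zero_lt_one.trans (one_lt_card_real Fq)) _
    have h5 : ‖T m l l'‖ ≤ 0 := by
      by_contra h
      exact absurd h4 (not_le.2 (mul_pos (not_le.1 h) hpos))
    rw [norm_le_zero_iff.1 h5, Matrix.zero_apply]

/-- If `|E_i| ≤ μ^(q^i)` for the earlier coefficients, the recursion gives `|E_m| ≤ D (μ/q)^(q^m)`.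
For large `m` this improves `μ` to `3μ/4`, and repeating the improvement makes `μ` arbitrarily
small. -/
theorem tendsto_norm_expC_mul (hθ : ‖theta Fq C‖ = Fintype.card Fq)
    (hN : G.NilpotentPartIntegral C) {B : ℝ} (hB : 0 ≤ B) (l l' : n) :
    Filter.Tendsto (fun i => ‖G.expC C i l l'‖ * B ^ (Fintype.card Fq ^ i))
      Filter.atTop (nhds 0) := by
  have hq := one_lt_card_real Fq
  have hq0 := zero_lt_one.trans hq
  have hq2 : (2 : ℝ) ≤ Fintype.card Fq := by exact_mod_cast Fintype.one_lt_card (α := Fq)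
  set E := G.expC C with hE
  -- As `ρ(t)` is a polynomial in `τ`, each `E_m` depends on only `N` predecessors, so a bound valid
  -- from some index on can be improved from a later index on.
  obtain ⟨N, hN0⟩ : ∃ N, ∀ i > N, G.rhoC C i = 0 := by
    refine ⟨G.rhoT.support.sup id, fun i hi => ?_⟩
    have : G.rhoT i = 0 := by
      by_contra h
      exact absurd (Finset.le_sup (f := id) (Finsupp.mem_support_iff.2 h)) (not_le.2 hi)
    rw [rhoC, this, Matrix.map_zero _ (map_zero _)]
  obtain ⟨D, hD0, hD⟩ : ∃ D : ℝ, 0 ≤ D ∧ ∀ i l l', ‖G.rhoC C i l l'‖ ≤ D := by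
    refine ⟨∑ i ∈ Finset.range (N + 1), ∑ l, ∑ l', ‖G.rhoC C i l l'‖, by positivity,
      fun i l l' => ?_⟩
    by_cases hi : i ≤ N
    · refine le_trans ?_ (Finset.single_le_sum
        (f := fun i => ∑ l, ∑ l', ‖G.rhoC C i l l'‖) (fun _ _ => by positivity)
        (Finset.mem_range.2 (Nat.lt_succ_iff.2 hi)))
      refine le_trans ?_ (Finset.single_le_sum
        (f := fun l => ∑ l', ‖G.rhoC C i l l'‖) (fun _ _ => by positivity) (Finset.mem_univ l))
      exact Finset.single_le_sum
        (f := fun l' => ‖G.rhoC C i l l'‖) (fun _ _ => by positivity) (Finset.mem_univ l')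
    · rw [hN0 i (not_le.1 hi), Matrix.zero_apply, norm_zero]
      positivity
  have step (μ : ℝ) (hμ : 0 ≤ μ) (m : ℕ) (hm : m ≠ 0)
      (h : ∀ i < m, m - i ≤ N → ∀ l l', ‖E i l l'‖ ≤ μ ^ (Fintype.card Fq ^ i)) (l l' : n) :
      ‖E m l l'‖ * (Fintype.card Fq : ℝ) ^ (Fintype.card Fq ^ m) ≤
        D * μ ^ (Fintype.card Fq ^ m) := by
    refine norm_mul_card_pow_le_of_sylvester hθ hN hm (fun l l' => ?_) l l'
    rw [hE, expC_sylvester, Matrix.sum_apply]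
    refine IsUltrametricDist.norm_sum_le_of_forall_le_of_nonneg (by positivity) fun i _ => ?_
    rw [Matrix.mul_apply]
    refine IsUltrametricDist.norm_sum_le_of_forall_le_of_nonneg (by positivity) fun j _ => ?_
    rw [norm_mul]
    by_cases hi : m - i ≤ N
    · refine mul_le_mul (hD _ _ _) ?_ (norm_nonneg _) hD0
      rw [Matrix.map_apply, frob_apply, norm_pow]
      refine (pow_le_pow_left₀ (norm_nonneg _) (h i i.2 hi _ _) _).trans (le_of_eq ?_)
      rw [← pow_mul, ← pow_add]
      congr 2
      have := i.2
      omega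
    · rw [hN0 _ (not_le.1 hi), Matrix.zero_apply, norm_zero, zero_mul]
      positivity
  -- Any number strictly between `1` and `2 ≤ q` would do: it absorbs `D` and leaves a contraction
  -- factor, here `3 / 4`.
  obtain ⟨m₀, hm₀⟩ : ∃ m₀ : ℕ, ∀ m ≥ m₀, D ≤ (3 / 2 : ℝ) ^ (Fintype.card Fq ^ m) := by
    have := ((tendsto_pow_atTop_atTop_of_one_lt (by norm_num : (1 : ℝ) < 3 / 2)).comp
      (tendsto_pow_atTop_atTop_of_one_lt (Fintype.one_lt_card (α := Fq)))).eventually_ge_atTop D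
    exact Filter.eventually_atTop.1 this
  have hle (m : ℕ) (hm : m ≥ m₀) : D ≤ (Fintype.card Fq : ℝ) ^ (Fintype.card Fq ^ m) *
      (3 / 4 : ℝ) ^ (Fintype.card Fq ^ m) := by
    rw [← mul_pow]
    exact (hm₀ m hm).trans (pow_le_pow_left₀ (by norm_num) (by linarith) _)
  have bound (μ : ℝ) (hμ : 0 ≤ μ) (m : ℕ) (hm : m ≠ 0) (hmm : m ≥ m₀)
      (h : ∀ i < m, m - i ≤ N → ∀ l l', ‖E i l l'‖ ≤ μ ^ (Fintype.card Fq ^ i)) (l l' : n) :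
      ‖E m l l'‖ ≤ (3 / 4 * μ) ^ (Fintype.card Fq ^ m) := by
    have hpos : 0 < (Fintype.card Fq : ℝ) ^ (Fintype.card Fq ^ m) := by positivity
    have h1 := (step μ hμ m hm h l l').trans
      (mul_le_mul_of_nonneg_right (hle m hmm) (by positivity))
    rw [mul_assoc, ← mul_pow, mul_comm] at h1
    exact le_of_mul_le_mul_left h1 hpos
  obtain ⟨μ, hμ1, hμ⟩ : ∃ μ : ℝ, 1 ≤ μ ∧ ∀ m l l', ‖E m l l'‖ ≤ μ ^ (Fintype.card Fq ^ m) := by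
    set μ : ℝ := 1 + ∑ m ∈ Finset.range (m₀ + 1), ∑ l, ∑ l', ‖E m l l'‖ with hμdef
    have hμ1 : 1 ≤ μ := le_add_of_nonneg_right (by positivity)
    refine ⟨μ, hμ1, fun m => ?_⟩
    induction m using Nat.strong_induction_on with
    | _ m ih =>
      by_cases hm : m < m₀ + 1
      · intro l l'
        refine le_trans ?_ (le_self_pow₀ hμ1 (pow_ne_zero _ Fintype.card_ne_zero))
        refine le_trans ?_ (le_add_of_nonneg_left zero_le_one)
        refine le_trans ?_ (Finset.single_le_sum
          (f := fun i => ∑ l, ∑ l', ‖E i l l'‖) (fun _ _ => by positivity)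
          (Finset.mem_range.2 hm))
        refine le_trans ?_ (Finset.single_le_sum
          (f := fun l => ∑ l', ‖E m l l'‖) (fun _ _ => by positivity) (Finset.mem_univ l))
        exact Finset.single_le_sum
          (f := fun l' => ‖E m l l'‖) (fun _ _ => by positivity) (Finset.mem_univ l')
      · intro l l'
        refine (bound μ (by linarith) m (by omega) (by omega) (fun i hi _ => ih i hi) l l').trans ?_
        exact pow_le_pow_left₀ (by linarith) (by linarith) _
  have iter (j : ℕ) : ∃ M, ∀ m ≥ M, ∀ l l',
      ‖E m l l'‖ ≤ ((3 / 4) ^ j * μ) ^ (Fintype.card Fq ^ m) := by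
    induction j with
    | zero => exact ⟨0, fun m _ l l' => by simpa using hμ m l l'⟩
    | succ j ih =>
      obtain ⟨M, hM⟩ := ih
      refine ⟨M + N + m₀ + 1, fun m hm l l' => ?_⟩
      rw [pow_succ', mul_assoc]
      exact bound _ (by positivity) m (by omega) (by omega)
        (fun i _ hi => hM i (by omega)) l l'
  -- Enough improvements beat the given `B`, leaving terms at most `(1/2)^(q^m)`.
  obtain ⟨j, hj⟩ : ∃ j : ℕ, (3 / 4 : ℝ) ^ j * (μ * B) < 1 / 2 := by
    have := (tendsto_pow_atTop_nhds_zero_of_lt_one (by norm_num : (0 : ℝ) ≤ 3 / 4)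
      (by norm_num)).mul_const (μ * B)
    rw [zero_mul] at this
    exact (this.eventually_lt_const (by norm_num)).exists
  obtain ⟨M, hM⟩ := iter j
  refine squeeze_zero' (Filter.Eventually.of_forall fun _ => by positivity)
    (Filter.eventually_atTop.2 ⟨M, fun m hm => ?_⟩)
    (tendsto_pow_card_pow Fq (by norm_num : (0 : ℝ) ≤ 1 / 2) (by norm_num))
  refine (mul_le_mul_of_nonneg_right (hM m hm l l') (by positivity)).trans ?_
  rw [← mul_pow]
  exact pow_le_pow_left₀ (by positivity) (by linarith) _

end TModule

end Entire

/-! ### Inversion of the logarithm series -/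

section Inversion

/-- The uniform bound leaves finitely many rows to inspect, and each of these has finitely many
large terms. In a complete ultrametric field this is all that rearranging a double series requires.
-/
theorem tendsto_cofinite_of_norm_le {C : Type*} [NormedField C] {u : ℕ × ℕ → C} {α : ℕ → ℝ}
    (hα : Filter.Tendsto α Filter.atTop (nhds 0)) (hu : ∀ i j, ‖u (i, j)‖ ≤ α i)
    (hu' : ∀ i, Filter.Tendsto (fun j => u (i, j)) Filter.atTop (nhds 0)) :
    Filter.Tendsto u Filter.cofinite (nhds 0) := by
  rw [Metric.tendsto_nhds]
  intro ε hε
  obtain ⟨I, hI⟩ := Filter.eventually_atTop.1 (hα.eventually_lt_const hε)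
  choose J hJ using fun i => Filter.eventually_atTop.1 (Metric.tendsto_nhds.1 (hu' i) ε hε)
  rw [Filter.eventually_cofinite]
  refine ((Finset.range I).sigma fun i => Finset.range (J i)).finite_toSet.image
    (fun x : (_ : ℕ) × ℕ => (x.1, x.2)) |>.subset ?_
  rintro ⟨i, j⟩ h
  refine ⟨⟨i, j⟩, ?_, rfl⟩
  simp only [Finset.coe_sigma, Set.mem_sigma_iff, Finset.mem_coe, Finset.mem_range]
  constructor
  · by_contra hi
    refine h ?_
    rw [dist_zero_right]
    exact (hu i j).trans_lt (hI i (not_lt.1 hi))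
  · by_contra hj
    exact h (hJ i j (not_lt.1 hj))

variable {Fq : Type*} [Field Fq] [Fintype Fq] {F : Type*} [Field F] [Algebra (RatFunc Fq) F]
  {C : Type*} [NormedField C] [Algebra (RatFunc Fq) C] [Algebra F C] [IsUltrametricDist C]
  [CompleteSpace C] {n : Type*} [Fintype n] [DecidableEq n] {G : TModule Fq F n}

theorem summable_mulVec_of_tendsto {P : ℕ → Matrix n n C} {c : n → C}
    (hc : ∀ l m, Filter.Tendsto (fun i => ‖P i l m‖ * ‖c m‖ ^ (Fintype.card Fq ^ i))
      Filter.atTop (nhds 0)) :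
    Summable fun i => (P i).mulVec fun l => c l ^ (Fintype.card Fq ^ i) := by
  rw [Pi.summable]
  intro l
  simp only [Matrix.mulVec, dotProduct]
  refine summable_sum fun m _ => ?_
  apply NonarchimedeanAddGroup.summable_of_tendsto_cofinite_zero
  rw [Nat.cofinite_eq_atTop, tendsto_zero_iff_norm_tendsto_zero]
  simpa only [norm_mul, norm_pow] using hc l m

namespace TModule

/-- A twisted power series `∑ᵢ Pᵢ τ ^ i` with `P₀ = 1` which intertwines `ρ(t)` and `∂ρ(t)` is
inverted by the exponential map wherever it converges. -/
theorem hasSum_expTerm_tsum_mulVec (hθ : ‖theta Fq C‖ = Fintype.card Fq)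
    (hN : G.NilpotentPartIntegral C) {P : ℕ → Matrix n n C} (hP0 : P 0 = 1)
    (hP : skewMul Fq (Pi.single 0 (G.rhoC C 0)) P = skewMul Fq P (G.rhoC C)) {c : n → C}
    (hc : ∀ l m, Filter.Tendsto (fun i => ‖P i l m‖ * ‖c m‖ ^ (Fintype.card Fq ^ i))
      Filter.atTop (nhds 0)) :
    HasSum (G.expTerm (∑' i, (P i).mulVec fun l => c l ^ (Fintype.card Fq ^ i))) c := by
  set y : ℕ → n → C := fun i => (P i).mulVec fun l => c l ^ (Fintype.card Fq ^ i) with hy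
  have hysum : Summable y := summable_mulVec_of_tendsto hc
  set Y := ∑' i, y i with hY
  have hsum (j : n) : HasSum (fun i => y i j) (Y j) := Pi.hasSum.1 hysum.hasSum j
  rw [Pi.hasSum]
  intro l
  set T : ℕ × ℕ → C := fun p => ∑ j, G.expC C p.1 l j * y p.2 j ^ (Fintype.card Fq ^ p.1) with hT
  have hTsum : Summable T := by
    refine summable_sum fun j _ => ?_
    apply NonarchimedeanAddGroup.summable_of_tendsto_cofinite_zero
    have htend : Filter.Tendsto (fun i => y i j) Filter.atTop (nhds 0) :=
      (hsum j).summable.tendsto_atTop_zero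
    -- Boundedness of the terms of `Y` suffices for uniformity in the rows, because the exponential
    -- series is entire.
    obtain ⟨B, hB⟩ := htend.norm.bddAbove_range
    have hB' (i) : ‖y i j‖ ≤ B := hB ⟨i, rfl⟩
    refine tendsto_cofinite_of_norm_le
      (tendsto_norm_expC_mul hθ hN ((norm_nonneg _).trans (hB' 0)) l j) (fun i i' => ?_) fun i => ?_
    · rw [norm_mul, norm_pow]
      exact mul_le_mul_of_nonneg_left (pow_le_pow_left₀ (norm_nonneg _) (hB' i') _) (norm_nonneg _)
    · have := (htend.pow (Fintype.card Fq ^ i)).const_mul (G.expC C i l j)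
      rwa [zero_pow (pow_ne_zero _ Fintype.card_ne_zero), mul_zero] at this
  have hrow (i : ℕ) : HasSum (fun i' => T (i, i')) (G.expTerm Y i l) := by
    refine hasSum_sum fun j _ => HasSum.mul_left _ ?_
    exact (hsum j).map (frob Fq C i) (continuous_pow (Fintype.card Fq ^ i))
  have hS := hTsum.hasSum
  -- Two evaluations of the same sum: here by rows, giving `Exp_G(Y)`; in `h2` by antidiagonals,
  -- giving the coefficients of `E P`.
  have h1 := hS.prod_fiberwise hrow
  have h2 := (Finset.HasAntidiagonal.sigmaAntidiagonalEquivProd.hasSum_iff.2 hS).sigma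
    (fun m => hasSum_fintype _)
  have h3 (m : ℕ) : ∑ p : Finset.HasAntidiagonal.antidiagonal m, T p.1 =
      ((skewMul Fq (G.expC C) P m).mulVec fun j => c j ^ (Fintype.card Fq ^ m)) l := by
    rw [Finset.sum_coe_sort (Finset.HasAntidiagonal.antidiagonal m) T, skewMul, Matrix.sum_mulVec,
      Finset.sum_apply]
    refine Finset.sum_congr rfl fun p hp => ?_
    rw [← Matrix.mulVec_mulVec, hT, Matrix.mulVec, dotProduct]
    refine Finset.sum_congr rfl fun j _ => ?_
    congr 1
    change frob Fq C p.1 (y p.2 j) = _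
    rw [hy, RingHom.map_mulVec]
    congr 1
    funext i
    rw [Function.comp_apply, frob_apply, ← pow_mul, ← pow_add, add_comm p.2,
      Finset.HasAntidiagonal.mem_antidiagonal.1 hp]
  have h4 : HasSum (fun m : ℕ => ((skewMul Fq (G.expC C) P m).mulVec
      fun j => c j ^ (Fintype.card Fq ^ m)) l) (∑' p, T p) := by
    convert h2 using 2 with m
    exact (h3 m).symm
  have h5 : HasSum (fun m : ℕ => ((skewMul Fq (G.expC C) P m).mulVec
      fun j => c j ^ (Fintype.card Fq ^ m)) l) (c l) := by
    rw [skewMul_expC_eq_one hθ hN hP0 hP]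
    convert hasSum_single (f := fun m : ℕ =>
      ((Pi.single 0 1 : ℕ → Matrix n n C) m).mulVec (fun j => c j ^ (Fintype.card Fq ^ m)) l) 0 ?_
    · simp
    · intro m hm
      rw [Pi.single_eq_of_ne hm, Matrix.zero_mulVec, Pi.zero_apply]
  rwa [h4.unique h5] at h1

end TModule

end Inversion

/-! ### Application to the `t`-module `G` -/

section

variable (Fq : Type*) [Field Fq] [Fintype Fq] {F : Type*} [Field F] [Algebra (RatFunc Fq) F]
  (C : Type*) [NormedField C] [Algebra (RatFunc Fq) C] [Algebra F C] [IsAlgClosed F]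
  [IsScalarTower (RatFunc Fq) F C] {k : ℕ} (s : Fin (k + 1) → ℕ+) (Q : Fin k → F[X])

/-- The nilpotent part is a shift inside blocks, so its entries are `0` or `1`. -/
theorem nilpotentPartIntegral_tModule : (tModule Fq F s Q).NilpotentPartIntegral C := by
  intro l m
  have h : ((tModule Fq F s Q).rhoC C 0 - theta Fq C • (1 : Matrix (Idx s) (Idx s) C)) l m =
      algebraMap F C ((rhoTCoeff Fq F s Q 0 - theta Fq F • (1 : Matrix (Idx s) (Idx s) F)) l m) := by
    rw [Matrix.sub_apply, Matrix.sub_apply, map_sub, Matrix.smul_apply, Matrix.smul_apply,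
      smul_eq_mul, smul_eq_mul, map_mul, algebraMap_theta, Matrix.one_apply, Matrix.one_apply]
    congr 2
    split_ifs <;> simp
  rw [h, rhoTCoeff_zero]
  split_ifs <;> simp

variable [IsUltrametricDist C] [CompleteSpace C]

theorem skewMul_logCoeff (hθ : ‖theta Fq C‖ = Fintype.card Fq) (hQ : CoeffBounded Fq C s Q) :
    skewMul Fq (Pi.single 0 ((tModule Fq F s Q).rhoC C 0)) (logCoeff Fq C s Q) =
      skewMul Fq (logCoeff Fq C s Q) ((tModule Fq F s Q).rhoC C) := by
  funext m
  rw [single_zero_skewMul, skewMul, ← Finset.Nat.sum_antidiagonal_swap,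
    Finset.Nat.sum_antidiagonal_eq_sum_range_succ_mk]
  exact rhoT_zero_mul_logCoeff Fq C s Q hθ hQ m

end

end TMot

open Polynomial TMot
theorem lemmaL (Fq : Type*) [Field Fq] [Fintype Fq]
    (𝕂 : IntermediateField (RatFunc Fq) (CInfty Fq)) [IsAlgClosed 𝕂]
    (k : ℕ) (s : Fin (k + 1) → ℕ+) (Q : Fin k → 𝕂[X])
    (hQ : ∀ i : Fin k,
      ((Q i).map (algebraMap 𝕂 (CInfty Fq))).gaussNorm
          (NormedField.toAbsoluteValue (CInfty Fq)) 1 ≤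
        (Fintype.card Fq : ℝ) ^
          (((s i.castSucc : ℕ) : ℝ) * (Fintype.card Fq : ℝ) / ((Fintype.card Fq : ℝ) - 1)))
    (c : Idx s → CInfty Fq)
    (hc : ∀ (i : Fin (k + 1)) (j : Fin (dSum s i)),
      ‖c ⟨i, j⟩‖ < (Fintype.card Fq : ℝ) ^
        (((j : ℕ) : ℝ) + 1 + (dSum s i : ℝ) / ((Fintype.card Fq : ℝ) - 1))) :
    (∀ n l m, InTate Fq (CInfty Fq) (logMatrix Fq 𝕂 (CInfty Fq) s Q n l m)) ∧
    Summable (logTerm Fq 𝕂 (CInfty Fq) s Q c) ∧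
    Summable ((tModule Fq 𝕂 s Q).expTerm (∑' n, logTerm Fq 𝕂 (CInfty Fq) s Q c n)) ∧
    (tModule Fq 𝕂 s Q).Exp (∑' n, logTerm Fq 𝕂 (CInfty Fq) s Q c n) = c := by
  have hθ := CInfty.norm_theta Fq
  -- The Gauss norm of radius `1` is `‖Q_j‖₁`, which dominates every coefficient.
  have hQ' : CoeffBounded Fq (CInfty Fq) s Q := fun j m => by
    refine le_trans ?_ (hQ j)
    have := Polynomial.le_gaussNorm (NormedField.toAbsoluteValue (CInfty Fq))
      ((Q j).map (algebraMap 𝕂 (CInfty Fq))) zero_le_one m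
    rwa [one_pow, mul_one, Polynomial.coeff_map] at this
  have hdecay (l m : Idx s) := tendsto_norm_logCoeff_mul Fq (CInfty Fq) s Q hθ hQ' l m
    (norm_nonneg (c m)) (hc m.1 m.2)
  have hExp := TModule.hasSum_expTerm_tsum_mulVec (G := tModule Fq 𝕂 s Q) hθ
    (nilpotentPartIntegral_tModule Fq (CInfty Fq) s Q) (logCoeff_zero Fq (CInfty Fq) s Q hθ)
    (skewMul_logCoeff Fq (CInfty Fq) s Q hθ hQ') hdecay
  exact ⟨inTate_logMatrix Fq (CInfty Fq) s Q hθ hQ', summable_mulVec_of_tendsto hdecay,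
    hExp.summable, hExp.tsum_eq⟩
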